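/- **Setting.** Let $n\ge 2$, let $D\subseteq\mathbb R^n$ be open, bounded and locally uniform, i.e. there are $\varepsilon\in(0,1]$, $\delta,c\in(0,\infty]$ such that any $x,y\in D$ with $|x-y|<\delta$ are joined in $D$ by a curve of length at most $\varepsilon^{-1}|x-y|$ all of whose points $z$ satisfy $\operatorname{dist}(z,\partial D)\ge \varepsilon|z-x||z-y|/|x-y|$, and all connected components of $D$ have diameter at least $c$. Let $\Gamma\subseteq\partial D$ be non-empty, relatively open, and a $d$-set for some $d\in(n-2,n)$: there is $c_0\in(0,1]$ with $c_0r^d\le\mathcal H^d(\Gamma\cap B(x,r))\le c_0^{-1}r^d$ for all $x\in\Gamma$, $r\in(0,1]$. Put $\sigma=\mathcal H^d|_\Gamma$. Let $\tilde q\in(\tfrac d{d+2-n},\infty]$, define $q$ by $1=\tfrac1{\tilde q}+\tfrac2q$, let $q'$ be its Hölder conjugate, and let $\gamma\colon W^{1,2}(D)\to L^q(\Gamma)=L^q(\Gamma,\sigma)$ be the trace operator, i.e. the extension by density of the restriction $u\mapsto u|_\Gamma$ from $W^{1,2}(D)\cap C(\overline D)$. All spaces are complex, and $X^*$ denotes the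 anti-dual of $X$. For $A\in L^\infty(D;\mathbb C^{n\times n})$ and $b\in L^{\tilde q}(\Gamma)$ let $$a(u,v)=\int_D A\nabla u\cdot\overline{\nabla v}\,dx+\int_\Gamma b\,\gamma(u)\overline{\gamma(v)}\,d\sigma,\qquad u,v\in W^{1,2}(D),$$ and assume $\operatorname{Re}a(u,u)\ge\lambda\|u\|_{W^{1,2}(D)}^2$ for all $u\in W^{1,2}(D)$, with some $\lambda>0$. Let $\mathcal L\colon W^{1,2}(D)\to W^{1,2}(D)^*$, $\langle\mathcal Lu,v\rangle=a(u,v)$, and let $S^*S\colon W^{1,2}(D)\to W^{1,2}(D)^*$ be the same operator for $A=\mathrm{Id}$, $b=1$. Let $\gamma^*\colon L^{q'}(\Gamma)\to W^{1,2}(D)^*$, $\langle\gamma^*g,v\rangle=\int_\Gamma g\,\overline{\gamma(v)}\,d\sigma$. For $t>0$ let $P_t=(1+t^2S^*S)^{-1}$ and $(1+t^2\mathcal L)^{-1}\colon W^{1,2}(D)^*\to W^{1,2}(D)$, where $1$ stands for the embedding $W^{1,2}(D)\subseteq L^2(D)\subseteq W^{1,2}(D)^*$ given by the $L^2(D)$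 inner product. **Lemma (Reduction to the interior).** There is a constant $C$, depending only on $n$, $D$, $\Gamma$, $d$, $\tilde q$, $\lambda$ and on upper bounds for $\|A\|_\infty$ and $\|b\|_{\tilde q}$, such that $$\int_0^1\bigl\|t(1+t^2\mathcal L)^{-1}\gamma^*b\,\gamma P_tu\bigr\|_{L^2(D)}^2\,\frac{dt}t\le C\,\|u\|_{W^{1,2}(D)}^2,\qquad u\in W^{1,2}(D).$$ -/

import Mathlib

open MeasureTheory Set Topology
open scoped ENNReal NNReal ComplexConjugate Matrix.Norms.L2Operator

noncomputable section

namespace RobinKato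

/-! ### Geometry -/

/-- Points of `ℝⁿ`, with the Euclidean norm. -/
abbrev Pt (n : ℕ) : Type := EuclideanSpace ℝ (Fin n)

/-- Vectors of `ℂⁿ`, with the Euclidean norm. -/
abbrev Vec (n : ℕ) : Type := EuclideanSpace ℂ (Fin n)

/-- `p : [0,1] → D` is an `ε`-cigar from `x` to `y` in `D`. -/
structure IsCigar {n : ℕ} (D : Set (Pt n)) (ε : ℝ) (x y : Pt n) (p : ℝ → Pt n) : Prop where
  continuousOn : ContinuousOn p (Icc 0 1)
  source : p 0 = x
  target : p 1 = y
  mapsTo : MapsTo p (Icc 0 1) D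
  length_le : eVariationOn p (Icc 0 1) ≤ ENNReal.ofReal (ε⁻¹ * dist x y)
  le_infDist : ∀ s ∈ Icc (0 : ℝ) 1,
    ε * dist (p s) x * dist (p s) y / dist x y ≤ Metric.infDist (p s) (frontier D)

/-- Locally uniform sets: nearby points are joined by cigars, and the diameters of the connected
components are bounded from below. -/
def IsLocallyUniform {n : ℕ} (D : Set (Pt n)) : Prop :=
  ∃ ε : ℝ, 0 < ε ∧ ε ≤ 1 ∧ ∃ δ : ℝ≥0∞, 0 < δ ∧ ∃ c : ℝ≥0∞, 0 < c ∧
    (∀ x ∈ D, ∀ y ∈ D, edist x y < δ → ∃ p : ℝ → Pt n, IsCigar D ε x y p) ∧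
    ∀ x ∈ D, c ≤ Metric.ediam (connectedComponentIn D x)

/-- `d`-sets, with respect to the `d`-dimensional Hausdorff measure. -/
def IsDSet {n : ℕ} (d : ℝ) (Γ : Set (Pt n)) : Prop :=
  ∃ c : ℝ, 0 < c ∧ c ≤ 1 ∧ ∀ x ∈ Γ, ∀ r : ℝ, 0 < r → r ≤ 1 →
    ENNReal.ofReal (c * r ^ d) ≤ μH[d] (Γ ∩ Metric.ball x r) ∧
    μH[d] (Γ ∩ Metric.ball x r) ≤ ENNReal.ofReal (c⁻¹ * r ^ d)

/-- The geometric setting: a bounded, open, locally uniform set `D ⊆ ℝⁿ`, `n ≥ 2`, together with a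
non-empty relatively open part `Γ` of its boundary which is a `d`-set, `n - 2 < d < n`. -/
structure Domain (n : ℕ) where
  D : Set (Pt n)
  Γ : Set (Pt n)
  d : ℝ
  two_le : 2 ≤ n
  isOpen : IsOpen D
  isBounded : Bornology.IsBounded D
  isLocallyUniform : IsLocallyUniform D
  nonempty : Γ.Nonempty
  relOpen : ∃ U : Set (Pt n), IsOpen U ∧ Γ = U ∩ frontier D
  lt_d : (n : ℝ) - 2 < d
  d_lt : d < n
  isDSet : IsDSet d Γ

variable {n : ℕ}

namespace Domain

variable (G : Domain n)

/-- Lebesgue measure on `D`. -/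
abbrev vol : Measure (Pt n) := volume.restrict G.D

/-- The `d`-dimensional Hausdorff measure on `Γ`. -/
abbrev σ : Measure (Pt n) := μH[G.d].restrict G.Γ

lemma subset_frontier : G.Γ ⊆ frontier G.D := by
  obtain ⟨U, -, h⟩ := G.relOpen
  rw [h]; exact inter_subset_right

lemma subset_closure : G.Γ ⊆ closure G.D := G.subset_frontier.trans frontier_subset_closure

lemma isCompact_closure : IsCompact (closure G.D) := G.isBounded.isCompact_closure

lemma measurableSet : MeasurableSet G.Γ := by
  obtain ⟨U, hU, h⟩ := G.relOpen
  rw [h]; exact hU.measurableSet.inter isClosed_frontier.measurableSet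

instance : IsFiniteMeasure G.vol :=
  isFiniteMeasure_restrict.2 G.isBounded.measure_lt_top.ne

instance : IsFiniteMeasure G.σ := by
  constructor
  rw [Measure.restrict_apply_univ]
  obtain ⟨c, hc, -, h⟩ := G.isDSet
  obtain ⟨t, htΓ, htf, hcov⟩ := exists_finite_cover_balls_of_isCompact_closure
    (G.isCompact_closure.of_isClosed_subset isClosed_closure
      (closure_minimal G.subset_closure isClosed_closure)) (one_pos : (0 : ℝ) < 1)
  have hsub : G.Γ ⊆ ⋃ x ∈ t, G.Γ ∩ Metric.ball x 1 := by
    intro y hy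
    obtain ⟨x, hx, hyx⟩ := mem_iUnion₂.1 (hcov hy)
    exact mem_iUnion₂.2 ⟨x, hx, hy, hyx⟩
  refine (measure_mono hsub).trans_lt ((measure_biUnion_lt_top htf) ?_)
  intro x hx
  exact ((h x (htΓ hx) 1 one_pos le_rfl).2).trans_lt ENNReal.ofReal_lt_top

end Domain

/-! ### The Sobolev space -/

/-- `g` is the distributional gradient of `u` in `D`. -/
def IsWeakGradient (D : Set (Pt n)) (u : Pt n → ℂ) (g : Pt n → Vec n) : Prop :=
  ∀ φ : Pt n → ℝ, ContDiff ℝ ((⊤ : ℕ∞) : WithTop ℕ∞) φ → HasCompactSupport φ → tsupport φ ⊆ D →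
    ∀ i : Fin n, ∫ x in D, fderiv ℝ φ x (EuclideanSpace.single i 1) • u x =
      -∫ x in D, φ x • g x i

lemma integrable_smul_of_test {D : Set (Pt n)} {ψ : Pt n → ℝ} (hc : Continuous ψ)
    (hs : HasCompactSupport ψ) {f : Pt n → ℂ} (hf : MemLp f 2 (volume.restrict D)) :
    Integrable (fun x => ψ x • f x) (volume.restrict D) := by
  have h := (hc.memLp_of_hasCompactSupport (p := 2) (μ := volume.restrict D) hs)
  have h2 := MemLp.smul (r := 1) hf h
  exact memLp_one_iff_integrable.1 h2

lemma memLp_coord {D : Set (Pt n)} {g : Pt n → Vec n} (hg : MemLp g 2 (volume.restrict D))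
    (i : Fin n) : MemLp (fun x => g x i) 2 (volume.restrict D) :=
  (EuclideanSpace.proj (𝕜 := ℂ) i : Vec n →L[ℂ] ℂ).comp_memLp' hg

lemma continuous_partial {φ : Pt n → ℝ} (hφ : ContDiff ℝ ((⊤ : ℕ∞) : WithTop ℕ∞) φ)
    (v : Pt n) : Continuous fun x => fderiv ℝ φ x v :=
  (hφ.continuous_fderiv (by simp)).clm_apply continuous_const

lemma hasCompactSupport_partial {φ : Pt n → ℝ} (hφ : HasCompactSupport φ)
    (v : Pt n) : HasCompactSupport fun x => fderiv ℝ φ x v :=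
  hφ.fderiv_apply (𝕜 := ℝ) v

/-- `W^{1,2}(D)` as the space of pairs `(u, ∇u)` in `L²(D) × L²(D)ⁿ`, where `∇u` is the
distributional gradient of `u`. -/
def sobolevSubmodule (D : Set (Pt n)) :
    Submodule ℂ (WithLp 2 (Lp ℂ 2 (volume.restrict D) × Lp (Vec n) 2 (volume.restrict D))) where
  carrier := {w | IsWeakGradient D w.fst w.snd}
  zero_mem' := by
    intro φ h1 h2 h3 i
    have e1 : ∫ x in D, fderiv ℝ φ x (EuclideanSpace.single i 1) •
        (0 : Lp ℂ 2 (volume.restrict D)) x = 0 := by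
      refine integral_eq_zero_of_ae ?_
      filter_upwards [Lp.coeFn_zero ℂ 2 (volume.restrict D)] with x hx
      rw [hx]; simp
    have e2 : ∫ x in D, φ x • (0 : Lp (Vec n) 2 (volume.restrict D)) x i = 0 := by
      refine integral_eq_zero_of_ae ?_
      filter_upwards [Lp.coeFn_zero (Vec n) 2 (volume.restrict D)] with x hx
      rw [hx]; simp
    change ∫ x in D, fderiv ℝ φ x (EuclideanSpace.single i 1) •
        (0 : Lp ℂ 2 (volume.restrict D)) x =
          -∫ x in D, φ x • (0 : Lp (Vec n) 2 (volume.restrict D)) x i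
    rw [e1, e2, neg_zero]
  add_mem' := by
    intro a b ha hb φ h1 h2 h3 i
    have hc := continuous_partial h1 (EuclideanSpace.single i 1)
    have hs := hasCompactSupport_partial h2 (EuclideanSpace.single i 1)
    have e1 : ∫ x in D, fderiv ℝ φ x (EuclideanSpace.single i 1) • (a + b).fst x =
        ∫ x in D, fderiv ℝ φ x (EuclideanSpace.single i 1) • a.fst x +
          fderiv ℝ φ x (EuclideanSpace.single i 1) • b.fst x := by
      refine integral_congr_ae ?_
      filter_upwards [Lp.coeFn_add a.fst b.fst] with x hx
      rw [← smul_add, WithLp.add_fst, hx, Pi.add_apply]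
    have e2 : ∫ x in D, φ x • (a + b).snd x i =
        ∫ x in D, φ x • a.snd x i + φ x • b.snd x i := by
      refine integral_congr_ae ?_
      filter_upwards [Lp.coeFn_add a.snd b.snd] with x hx
      rw [← smul_add, WithLp.add_snd, hx, Pi.add_apply, PiLp.add_apply]
    rw [e1, e2, integral_add (integrable_smul_of_test hc hs (Lp.memLp _))
      (integrable_smul_of_test hc hs (Lp.memLp _)),
      integral_add (integrable_smul_of_test h1.continuous h2 (memLp_coord (Lp.memLp _) i))
      (integrable_smul_of_test h1.continuous h2 (memLp_coord (Lp.memLp _) i)),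
      ha φ h1 h2 h3 i, hb φ h1 h2 h3 i, neg_add]
  smul_mem' := by
    intro c a ha φ h1 h2 h3 i
    have e1 : ∫ x in D, fderiv ℝ φ x (EuclideanSpace.single i 1) • (c • a).fst x =
        ∫ x in D, c • (fderiv ℝ φ x (EuclideanSpace.single i 1) • a.fst x) := by
      refine integral_congr_ae ?_
      filter_upwards [Lp.coeFn_smul c a.fst] with x hx
      rw [WithLp.smul_fst, hx, Pi.smul_apply, smul_comm]
    have e2 : ∫ x in D, φ x • (c • a).snd x i = ∫ x in D, c • (φ x • a.snd x i) := by
      refine integral_congr_ae ?_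
      filter_upwards [Lp.coeFn_smul c a.snd] with x hx
      rw [WithLp.smul_snd, hx, Pi.smul_apply, PiLp.smul_apply, smul_comm]
    rw [e1, e2, integral_smul, integral_smul, ha φ h1 h2 h3 i, smul_neg]

/-- The anti-dual of a complex normed space: bounded conjugate-linear functionals. -/
abbrev AntiDual (V : Type*) [NormedAddCommGroup V] [NormedSpace ℂ V] : Type _ := V →L⋆[ℂ] ℂ

namespace Domain

variable (G : Domain n)

/-- `L²(D)`. -/
abbrev L2 : Type := Lp ℂ 2 G.vol

/-- `L²(D)ⁿ`. -/
abbrev L2n : Type := Lp (Vec n) 2 G.vol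

/-- `W^{1,2}(D)`, a Hilbert space with `‖u‖² = ‖u‖²_{L²(D)} + ‖∇u‖²_{L²(D)}`. -/
abbrev W12 : Type := sobolevSubmodule G.D

/-- The inclusion `W^{1,2}(D) → L²(D)`. -/
def incl : G.W12 →L[ℂ] G.L2 := (WithLp.fstL 2 ℂ G.L2 G.L2n).comp (sobolevSubmodule G.D).subtypeL

/-- The gradient `∇ : W^{1,2}(D) → L²(D)ⁿ`. -/
def grad : G.W12 →L[ℂ] G.L2n := (WithLp.sndL 2 ℂ G.L2 G.L2n).comp (sobolevSubmodule G.D).subtypeL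

lemma norm_sq_eq (u : G.W12) : ‖u‖ ^ 2 = ‖G.incl u‖ ^ 2 + ‖G.grad u‖ ^ 2 := by
  have := WithLp.prod_norm_sq_eq_of_L2 (u : WithLp 2 (G.L2 × G.L2n))
  exact this

/-! ### The trace operator -/

/-- The functions in `W^{1,2}(D)` which have a continuous extension to the closure of `D`. -/
def contSubmodule : Submodule ℂ G.W12 where
  carrier := {u | ∃ f : Pt n → ℂ, ContinuousOn f (closure G.D) ∧ G.incl u =ᵐ[G.vol] f}
  zero_mem' := by
    refine ⟨0, continuousOn_const, ?_⟩
    rw [map_zero]; exact Lp.coeFn_zero _ _ _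
  add_mem' := by
    rintro u v ⟨f, hf, huf⟩ ⟨g, hg, hvg⟩
    refine ⟨f + g, hf.add hg, ?_⟩
    rw [map_add]
    exact (Lp.coeFn_add _ _).trans (huf.add hvg)
  smul_mem' := by
    rintro c u ⟨f, hf, huf⟩
    refine ⟨c • f, hf.const_smul c, ?_⟩
    rw [map_smul]
    exact (Lp.coeFn_smul _ _).trans (huf.const_smul c)

/-- The continuous representative of `u` on the closure of `D`. -/
def contRep (u : G.contSubmodule) : Pt n → ℂ := u.2.choose

lemma continuousOn_contRep (u : G.contSubmodule) : ContinuousOn (G.contRep u) (closure G.D) :=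
  u.2.choose_spec.1

lemma contRep_ae (u : G.contSubmodule) : G.incl u =ᵐ[G.vol] G.contRep u :=
  u.2.choose_spec.2

lemma contRep_unique (u : G.contSubmodule) {f : Pt n → ℂ} (hf : ContinuousOn f (closure G.D))
    (h : G.incl u =ᵐ[G.vol] f) : EqOn (G.contRep u) f (closure G.D) := by
  have h1 : EqOn (G.contRep u) f G.D :=
    Measure.eqOn_open_of_ae_eq ((G.contRep_ae u).symm.trans h) G.isOpen
      ((G.continuousOn_contRep u).mono _root_.subset_closure) (hf.mono _root_.subset_closure)
  exact h1.of_subset_closure (G.continuousOn_contRep u) hf _root_.subset_closure subset_rfl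

lemma memLp_contRep (q : ℝ≥0∞) (u : G.contSubmodule) : MemLp (G.contRep u) q G.σ := by
  obtain ⟨C, hC⟩ := G.isCompact_closure.exists_bound_of_continuousOn (G.continuousOn_contRep u)
  refine MemLp.of_bound
    (((G.continuousOn_contRep u).mono G.subset_closure).aestronglyMeasurable G.measurableSet) C ?_
  exact (ae_restrict_mem G.measurableSet).mono fun x hx => hC x (G.subset_closure hx)

lemma contRep_add (u v : G.contSubmodule) :
    G.contRep (u + v) =ᵐ[G.σ] G.contRep u + G.contRep v := by
  refine (ae_restrict_mem G.measurableSet).mono fun x hx => ?_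
  refine G.contRep_unique (u + v)
    ((G.continuousOn_contRep u).add (G.continuousOn_contRep v)) ?_ (G.subset_closure hx)
  have h : G.incl ((u + v : G.contSubmodule) : G.W12) = G.incl u + G.incl v := map_add G.incl _ _
  rw [h]
  exact (Lp.coeFn_add _ _).trans ((G.contRep_ae u).add (G.contRep_ae v))

lemma contRep_smul (c : ℂ) (u : G.contSubmodule) :
    G.contRep (c • u) =ᵐ[G.σ] c • G.contRep u := by
  refine (ae_restrict_mem G.measurableSet).mono fun x hx => ?_
  refine G.contRep_unique (c • u) ((G.continuousOn_contRep u).const_smul c) ?_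
    (G.subset_closure hx)
  have h : G.incl ((c • u : G.contSubmodule) : G.W12) = c • G.incl u := map_smul G.incl _ _
  rw [h]
  exact (Lp.coeFn_smul _ _).trans ((G.contRep_ae u).const_smul c)

/-- Restriction to `Γ` of the functions in `W^{1,2}(D)` that are continuous up to the boundary. -/
def restrictLinear (q : ℝ≥0∞) : G.contSubmodule →ₗ[ℂ] Lp ℂ q G.σ where
  toFun u := (G.memLp_contRep q u).toLp
  map_add' u v :=
    (MemLp.toLp_congr _ ((G.memLp_contRep q u).add (G.memLp_contRep q v))
      (G.contRep_add u v)).trans (MemLp.toLp_add _ _)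
  map_smul' c u :=
    (MemLp.toLp_congr _ ((G.memLp_contRep q u).const_smul c)
      (G.contRep_smul c u)).trans (MemLp.toLp_const_smul c _)

/-- The trace operator `γ : W^{1,2}(D) → L^q(Γ)`: the extension by density of the restriction to
`Γ` of functions that are continuous up to the boundary. These functions are dense in `W^{1,2}(D)` and the
restriction is bounded in the norm of `W^{1,2}(D)` for the exponents `q` of interest. -/
def trace (q : ℝ≥0∞) [Fact (1 ≤ q)] : G.W12 →L[ℂ] Lp ℂ q G.σ :=
  (G.restrictLinear q).extendOfNorm G.contSubmodule.subtype

/-! ### The operators -/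

/-- The embedding `L²(D) → (W^{1,2}(D))*`, `⟨f, v⟩ = ∫_D f v̄`. -/
def emb : G.L2 →L[ℂ] AntiDual G.W12 :=
  ContinuousLinearMap.bilinearComp (innerSL ℂ).flip (ContinuousLinearMap.id ℂ G.L2) G.incl

lemma emb_apply (f : G.L2) (v : G.W12) : G.emb f v = ∫ x in G.D, f x * conj (G.incl v x) := by
  change inner ℂ (G.incl v) f = _
  rw [L2.inner_def]
  exact integral_congr_ae (.of_forall fun x => by simp [RCLike.inner_apply])

/-- `∇* = -Div : L²(D)ⁿ → (W^{1,2}(D))*`, `⟨∇* F, v⟩ = ∫_D F · conj (∇ v)`. -/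
def gradAdj : G.L2n →L[ℂ] AntiDual G.W12 :=
  ContinuousLinearMap.bilinearComp (innerSL ℂ).flip (ContinuousLinearMap.id ℂ G.L2n) G.grad

/-- Pointwise complex conjugation on `L^q(Γ)`. -/
def conjLp (q : ℝ≥0∞) [Fact (1 ≤ q)] : Lp ℂ q G.σ →L⋆[ℂ] Lp ℂ q G.σ :=
  LinearMap.mkContinuous
    { toFun := fun f => star f
      map_add' := fun f g => by
        refine Lp.ext ?_
        filter_upwards [Lp.coeFn_star (f + g), Lp.coeFn_add (star f) (star g), Lp.coeFn_star f,
          Lp.coeFn_star g, Lp.coeFn_add f g] with x h1 h2 h3 h4 h5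
        rw [h1, h2, Pi.star_apply, h5, Pi.add_apply, Pi.add_apply, h3, h4, star_add]
        rfl
      map_smul' := fun c f => by
        refine Lp.ext ?_
        filter_upwards [Lp.coeFn_star (c • f), Lp.coeFn_smul (starRingEnd ℂ c) (star f),
          Lp.coeFn_star f, Lp.coeFn_smul c f] with x h1 h2 h3 h4
        rw [h1, h2, Pi.star_apply, h4, Pi.smul_apply, Pi.smul_apply, h3, star_smul]
        rfl }
    1 (fun f => by
      rw [one_mul]
      refine Lp.norm_le_norm_of_ae_le ?_
      filter_upwards [Lp.coeFn_star f] with x hx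
      change ‖(star f : Lp ℂ q G.σ) x‖ ≤ _
      rw [hx, Pi.star_apply, norm_star])

section

variable (q q' : ℝ≥0∞) [Fact (1 ≤ q)] [Fact (1 ≤ q')] [ENNReal.HolderConjugate q' q]

/-- `γ* : L^{q'}(Γ) → (W^{1,2}(D))*`, `⟨γ* g, v⟩ = ∫_Γ g conj (γ v)`. -/
def traceAdj : Lp ℂ q' G.σ →L[ℂ] AntiDual G.W12 :=
  ContinuousLinearMap.bilinearComp ((ContinuousLinearMap.mul ℂ ℂ).lpPairing G.σ q' q)
    (ContinuousLinearMap.id ℂ (Lp ℂ q' G.σ)) ((G.conjLp q).comp (G.trace q))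

lemma traceAdj_apply (g : Lp ℂ q' G.σ) (v : G.W12) :
    G.traceAdj q q' g v = ∫ x, g x * conj (G.trace q v x) ∂G.σ := by
  change (ContinuousLinearMap.mul ℂ ℂ).lpPairing G.σ q' q g (star (G.trace q v)) = _
  rw [ContinuousLinearMap.lpPairing_eq_integral]
  refine integral_congr_ae ?_
  filter_upwards [Lp.coeFn_star (G.trace q v)] with x hx
  rw [hx]; rfl

end

/-- Pointwise action of a coefficient matrix `A ∈ L^∞(D; ℂ^{n×n})` on `L²(D)ⁿ`. -/
def mulA (A : Lp (Matrix (Fin n) (Fin n) ℂ) ⊤ G.vol) : G.L2n →L[ℂ] G.L2n :=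
  ContinuousLinearMap.holderL G.vol ⊤ 2 2
    (LinearMap.toContinuousLinearMap
      (Matrix.toEuclideanCLM (n := Fin n) (𝕜 := ℂ)).toAlgEquiv.toLinearMap) A

section

variable {r q q' : ℝ≥0∞} [Fact (1 ≤ r)] [Fact (1 ≤ q)] [Fact (1 ≤ q')]
  [ENNReal.HolderTriple r q q'] [ENNReal.HolderConjugate q' q]

/-- Multiplication `L^q(Γ) → L^{q'}(Γ)` by `b ∈ L^r(Γ)`, where `1/r + 1/q = 1/q'`. -/
def mulB (b : Lp ℂ r G.σ) : Lp ℂ q G.σ →L[ℂ] Lp ℂ q' G.σ :=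
  (ContinuousLinearMap.mul ℂ ℂ).holderL G.σ r q q' b

variable (q q')

/-- The sesquilinear form
`a(u,v) = ∫_D A ∇u · conj (∇v) dx + ∫_Γ b γ(u) conj (γ(v)) dσ`. -/
def form (A : Lp (Matrix (Fin n) (Fin n) ℂ) ⊤ G.vol) (b : Lp ℂ r G.σ) (u v : G.W12) : ℂ :=
  (∫ x in G.D, inner ℂ (G.grad v x) (Matrix.toEuclideanCLM (n := Fin n) (𝕜 := ℂ) (A x) (G.grad u x)))
    + ∫ x, b x * G.trace q u x * conj (G.trace q v x) ∂G.σ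

/-- The weak operator `𝓛 = S* B S = ∇* A ∇ + γ* b γ : W^{1,2}(D) → (W^{1,2}(D))*`. -/
def robinOp (A : Lp (Matrix (Fin n) (Fin n) ℂ) ⊤ G.vol) (b : Lp ℂ r G.σ) :
    G.W12 →L[ℂ] AntiDual G.W12 :=
  G.gradAdj ∘L G.mulA A ∘L G.grad + G.traceAdj q q' ∘L G.mulB b ∘L G.trace q

/-- `⟨𝓛 u, v⟩ = a(u,v)`. -/
lemma robinOp_apply (A : Lp (Matrix (Fin n) (Fin n) ℂ) ⊤ G.vol) (b : Lp ℂ r G.σ) (u v : G.W12) :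
    G.robinOp q q' A b u v = G.form q A b u v := by
  have h1 : G.gradAdj (G.mulA A (G.grad u)) v = ∫ x in G.D, inner ℂ (G.grad v x)
      (Matrix.toEuclideanCLM (n := Fin n) (𝕜 := ℂ) (A x) (G.grad u x)) := by
    change inner ℂ (G.grad v) (G.mulA A (G.grad u)) = _
    rw [L2.inner_def]
    refine integral_congr_ae ?_
    filter_upwards [ContinuousLinearMap.coeFn_holder (r := 2) (LinearMap.toContinuousLinearMap
      (Matrix.toEuclideanCLM (n := Fin n) (𝕜 := ℂ)).toAlgEquiv.toLinearMap) A (G.grad u)] with x hx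
    exact congrArg (inner ℂ (G.grad v x)) hx
  have h2 : G.traceAdj q q' (G.mulB b (G.trace q u)) v =
      ∫ x, b x * G.trace q u x * conj (G.trace q v x) ∂G.σ := by
    rw [traceAdj_apply]
    refine integral_congr_ae ?_
    filter_upwards [ContinuousLinearMap.coeFn_holder (r := q') (ContinuousLinearMap.mul ℂ ℂ) b
      (G.trace q u)] with x hx
    exact congrArg (· * conj (G.trace q v x)) hx
  exact congrArg₂ (· + ·) h1 h2

/-- The weak Laplacian `S* S`: the coefficients are `A = 1` and `b = 1`. -/
def laplacian (r : ℝ≥0∞) [Fact (1 ≤ r)] [ENNReal.HolderTriple r q q'] :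
    G.W12 →L[ℂ] AntiDual G.W12 :=
  G.robinOp q q' (Lp.const ⊤ G.vol 1) (Lp.const r G.σ 1)

end

/-- The resolvent `(1 + t² T)⁻¹ : (W^{1,2}(D))* → W^{1,2}(D)`, where `1` stands for the canonical
embedding `W^{1,2}(D) → L²(D) → (W^{1,2}(D))*`. For `t > 0` the inverse exists by the Lax-Milgram
lemma, both for `S* S` and for `𝓛` under the Gårding inequality. -/
def resolvent (T : G.W12 →L[ℂ] AntiDual G.W12) (t : ℝ) : AntiDual G.W12 →L[ℂ] G.W12 :=
  (G.emb ∘L G.incl + ((t : ℂ) ^ 2) • T).inverse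

/-- The smoothing operator `P_t = (1 + t² S* S)⁻¹` on `L²(D)`; its values lie in `W^{1,2}(D)`. -/
def smoothing (q q' r : ℝ≥0∞) [Fact (1 ≤ q)] [Fact (1 ≤ q')] [Fact (1 ≤ r)]
    [ENNReal.HolderTriple r q q'] [ENNReal.HolderConjugate q' q] (t : ℝ) : G.L2 →L[ℂ] G.W12 :=
  G.resolvent (G.laplacian q q' r) t ∘L G.emb

/-- The boundary term `t (1 + t² 𝓛)⁻¹ γ* b γ P_t u`, an element of `L²(D)`. -/
def boundaryTerm (q q' : ℝ≥0∞) {r : ℝ≥0∞} [Fact (1 ≤ q)] [Fact (1 ≤ q')] [Fact (1 ≤ r)]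
    [ENNReal.HolderTriple r q q'] [ENNReal.HolderConjugate q' q]
    (A : Lp (Matrix (Fin n) (Fin n) ℂ) ⊤ G.vol) (b : Lp ℂ r G.σ) (t : ℝ) (u : G.W12) : G.L2 :=
  (t : ℂ) • G.incl (G.resolvent (G.robinOp q q' A b) t
    (G.traceAdj q q' (G.mulB b (G.trace q (G.smoothing q q' r t (G.incl u))))))

end Domain
end RobinKato

end

/-! The boundary term is subcritical: it decays like a positive power of `t`, so no cancellation or
genuine quadratic estimate is needed. With `α = 1 - n/2 + d/q`, the pointwise bound `‖t (1 + t² 𝓛)⁻¹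
γ* b γ P_t u‖ ≤ N t^α ‖u‖` holds for `0 < t ≤ 1`, and `∫₀¹ t^(2α-1) dt = 1/(2α)` finishes the proof.
The condition on `r` (the exponent `q̃` of `b`) says exactly that `α > 0`: from `1/r + 2/q = 1` and
`1/r < (d+2-n)/d` one gets `2d/q > n - 2`.

The bound combines three facts.

Scaled trace inequality (`exists_norm_trace_le`): `‖γ v‖_q ≤ C t^(α-1) (‖v‖₂ + t ‖∇v‖₂)`. By Hölder,
the functional `γ* b γ P_t u` is then bounded by `t^(α-1) ‖γ P_t u‖_q` times the scaled norm `‖v‖₂ +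
t ‖∇v‖₂`.

Resolvent bound (`norm_inverse_shifted_le`): `1 + t² 𝓛` is coercive in the scaled norm uniformly in
`t`, so its inverse maps such functionals to `L²(D)` with no loss; the prefactor `t` turns `t^(α-1)`
into `t^α`.

Uniform bound for `P_t` on `W^{1,2}(D)` (`norm_sq_inverse_shifted_le`): `S* S` is symmetric, so
`P_t` decreases its energy. For `γ P_t u` the unscaled trace bound therefore suffices.

The scaled trace inequality is proved by hand. For `x ∈ Γ`, local uniformity gives corkscrew points
at the scales `h/2^j`, joined by cigars that stay away from the boundary. Mollifications of `v` at
these points tend to `v(x)`, and consecutive ones differ by at most a multiple of the scale times an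
average of `|∇v|` over a comparable ball (`IsLocallyUniform.exists_approx`). Cauchy–Schwarz, Tonelli
and the upper `d`-set bound convert the `j`-th term, in `L^q(Γ)`, into `(h/2^j)^α ‖∇v‖₂`, a
convergent geometric series. -/

namespace RobinKato

/-! ### Lax–Milgram for maps into the anti-dual -/

section LaxMilgram

variable {V : Type*} [NormedAddCommGroup V] [InnerProductSpace ℂ V] [CompleteSpace V]

/-- The Riesz isomorphism of a Hilbert space onto its anti-dual. -/
noncomputable def rieszAntiDual (V : Type*) [NormedAddCommGroup V] [InnerProductSpace ℂ V]
    [CompleteSpace V] : V ≃L[ℂ] AntiDual V :=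
  ContinuousLinearEquiv.ofBijective ((innerSL ℂ : V →L⋆[ℂ] V →L[ℂ] ℂ).flip)
    (by
      refine LinearMap.ker_eq_bot'.2 fun w hw => ?_
      have h : inner ℂ w w = 0 := DFunLike.congr_fun hw w
      exact inner_self_eq_zero.1 h)
    (by
      refine LinearMap.range_eq_top.2 fun f => ?_
      let g : V →L[ℂ] ℂ := (starL ℂ : ℂ ≃L⋆[ℂ] ℂ).toContinuousLinearMap.comp f
      refine ⟨(InnerProductSpace.toDual ℂ V).symm g, ?_⟩
      ext v
      change inner ℂ v ((InnerProductSpace.toDual ℂ V).symm g) = f v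
      rw [← inner_conj_symm, InnerProductSpace.toDual_symm_apply]
      exact Complex.conj_conj (f v))

lemma rieszAntiDual_apply (w v : V) : rieszAntiDual V w v = inner ℂ v w := rfl

/-- The Lax–Milgram lemma for operators into the anti-dual. -/
lemma isInvertible_of_coercive (T : V →L[ℂ] AntiDual V) {c : ℝ} (hc : 0 < c)
    (h : ∀ u, c * ‖u‖ ^ 2 ≤ (T u u).re) : T.IsInvertible := by
  set S : V →L[ℂ] V := (rieszAntiDual V).symm.toContinuousLinearMap ∘L T with hS
  have hST : ∀ u v, inner ℂ v (S u) = T u v := fun u v => by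
    rw [← rieszAntiDual_apply]
    simp [hS]
  have hb : ∀ u, c * ‖u‖ ≤ ‖S u‖ := by
    intro u
    rcases eq_or_ne u 0 with rfl | hu
    · simp
    have hu' : 0 < ‖u‖ := norm_pos_iff.2 hu
    have h1 : c * ‖u‖ ^ 2 ≤ ‖u‖ * ‖S u‖ := by
      refine (h u).trans ((Complex.re_le_norm _).trans ?_)
      rw [← hST]
      exact norm_inner_le_norm _ _
    nlinarith
  have hanti : AntilipschitzWith (c⁻¹.toNNReal) S := by
    refine S.antilipschitz_of_bound fun u => ?_
    rw [Real.coe_toNNReal _ (inv_pos.2 hc).le, ← div_eq_inv_mul, le_div_iff₀ hc, mul_comm]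
    exact hb u
  have hker : S.ker = ⊥ := LinearMap.ker_eq_bot.2 hanti.injective
  have hclosed : IsClosed (S.range : Set V) := hanti.isClosed_range S.uniformContinuous
  have hrange : S.range = ⊤ := by
    have := hclosed.completeSpace_coe
    -- The range is closed, hence equal to its double orthogonal complement. A vector `w` orthogonal
    -- to the range satisfies `T w w = 0`, so coercivity forces `w = 0`.
    rw [← S.range.orthogonal_orthogonal, Submodule.eq_top_iff']
    intro v w hw
    have h0 : inner ℂ (S w) w = 0 := hw _ ⟨w, rfl⟩
    have h1 : T w w = 0 := by rw [← hST, ← inner_conj_symm, h0, map_zero]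
    have h2 := h w
    rw [h1, Complex.zero_re] at h2
    have h3 : ‖w‖ = 0 := by
      have : ‖w‖ ^ 2 ≤ 0 := by nlinarith [sq_nonneg ‖w‖]
      nlinarith [sq_nonneg ‖w‖]
    rw [norm_eq_zero.1 h3, inner_zero_left]
  refine ⟨(ContinuousLinearEquiv.ofBijective S hker hrange).trans (rieszAntiDual V), ?_⟩
  ext u v
  change rieszAntiDual V (S u) v = T u v
  rw [rieszAntiDual_apply, hST]

end LaxMilgram

/-! ### Abstract resolvent estimates -/

section Resolvent

variable {V X Y : Type*} [NormedAddCommGroup V] [InnerProductSpace ℂ V]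
  [NormedAddCommGroup X] [InnerProductSpace ℂ X] [NormedAddCommGroup Y] [InnerProductSpace ℂ Y]

/-- The weak operator `1 + t² T`, where `1` stands for the embedding of `V` into its anti-dual
via `ι : V → X` and `E : X → V*`. -/
noncomputable abbrev shifted (ι : V →L[ℂ] X) (E : X →L[ℂ] AntiDual V) (T : V →L[ℂ] AntiDual V)
    (t : ℝ) : V →L[ℂ] AntiDual V :=
  E ∘L ι + ((t : ℂ) ^ 2) • T

variable {ι : V →L[ℂ] X} {D : V →L[ℂ] Y} {E : X →L[ℂ] AntiDual V} {T : V →L[ℂ] AntiDual V}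

lemma shifted_apply (hE : ∀ f v, E f v = inner ℂ (ι v) f) (t : ℝ) (u v : V) :
    shifted ι E T t u v = inner ℂ (ι v) (ι u) + (t : ℂ) ^ 2 * T u v := by
  rw [← hE]; rfl

lemma re_sq_mul (t : ℝ) (z : ℂ) : ((t : ℂ) ^ 2 * z).re = t ^ 2 * z.re := by
  rw [← Complex.ofReal_pow, Complex.re_ofReal_mul]

lemma re_inner_self_eq (x : X) : (inner ℂ x x).re = ‖x‖ ^ 2 := by
  rw [inner_self_eq_norm_sq_to_K]
  norm_cast

lemma isInvertible_shifted [CompleteSpace V] (hE : ∀ f v, E f v = inner ℂ (ι v) f)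
    (hV : ∀ u, ‖u‖ ^ 2 = ‖ι u‖ ^ 2 + ‖D u‖ ^ 2) {c : ℝ} (hc : 0 < c)
    (hT : ∀ u, c * ‖D u‖ ^ 2 ≤ (T u u).re) {t : ℝ} (ht : 0 < t) :
    (shifted ι E T t).IsInvertible := by
  have hm : 0 < min 1 (t ^ 2 * c) := lt_min one_pos (by positivity)
  refine isInvertible_of_coercive _ hm fun u => ?_
  rw [shifted_apply hE, Complex.add_re, re_sq_mul, re_inner_self_eq, hV, mul_add]
  have h1 := mul_le_mul_of_nonneg_right (min_le_left 1 (t ^ 2 * c)) (sq_nonneg ‖ι u‖)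
  have h2 := mul_le_mul_of_nonneg_right (min_le_right 1 (t ^ 2 * c)) (sq_nonneg ‖D u‖)
  have h3 := mul_le_mul_of_nonneg_left (hT u) (sq_nonneg t)
  linarith

lemma inverse_shifted_spec (hE : ∀ f v, E f v = inner ℂ (ι v) f) {t : ℝ}
    (h : (shifted ι E T t).IsInvertible) (f : AntiDual V) (v : V) :
    inner ℂ (ι v) (ι ((shifted ι E T t).inverse f))
      + (t : ℂ) ^ 2 * T ((shifted ι E T t).inverse f) v = f v := by
  rw [← shifted_apply hE]
  obtain ⟨e, he⟩ := h
  rw [← he, ContinuousLinearMap.inverse_equiv]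
  exact DFunLike.congr_fun (e.apply_symm_apply f) v

lemma continuous_add_sq_smul {W : Type*} [NormedAddCommGroup W] [NormedSpace ℂ W] (a b : W) :
    Continuous fun t : ℝ => a + ((t : ℂ) ^ 2) • b := by
  fun_prop

/-- Inversion is continuous at invertible operators. This supplies the measurability in `t` of the
square function. -/
lemma continuousOn_inverse_shifted [CompleteSpace V] {s : Set ℝ} (h : ∀ t ∈ s, (shifted ι E T t).IsInvertible) :
    ContinuousOn (fun t : ℝ => (shifted ι E T t).inverse) s := by
  intro t ht
  obtain ⟨e, he⟩ := h t ht
  have h1 : ContinuousAt ContinuousLinearMap.inverse (shifted ι E T t) := by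
    rw [← he]
    exact (contDiffAt_map_inverse (n := 0) e).continuousAt
  have h2 : ContinuousAt (fun t : ℝ => shifted ι E T t) t := by
    exact (continuous_add_sq_smul (W := V →L[ℂ] AntiDual V) (E ∘L ι) T).continuousAt
  exact (ContinuousAt.comp (f := fun t : ℝ => shifted ι E T t) h1 h2).continuousWithinAt

/-- The resolvent maps functionals which are controlled by the scaled norm
`‖ι v‖ + t ‖D v‖` boundedly into `X`. -/
lemma norm_inverse_shifted_le [CompleteSpace V] (hE : ∀ f v, E f v = inner ℂ (ι v) f)
    (hV : ∀ u, ‖u‖ ^ 2 = ‖ι u‖ ^ 2 + ‖D u‖ ^ 2) {c : ℝ} (hc : 0 < c)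
    (hT : ∀ u, c * ‖D u‖ ^ 2 ≤ (T u u).re) {t : ℝ} (ht : 0 < t)
    {f : AntiDual V} {N : ℝ} (hN : 0 ≤ N) (hf : ∀ v, ‖f v‖ ≤ N * (‖ι v‖ + t * ‖D v‖)) :
    ‖ι ((shifted ι E T t).inverse f)‖ ≤ 2 / min 1 c * N := by
  set w := (shifted ι E T t).inverse f with hw
  -- Test the equation with its own solution `w`.
  have h0 := congrArg Complex.re
    (inverse_shifted_spec hE (isInvertible_shifted hE hV hc hT ht) f w)
  rw [← hw, Complex.add_re, re_sq_mul, re_inner_self_eq] at h0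
  have h1 : (f w).re ≤ N * (‖ι w‖ + t * ‖D w‖) := (Complex.re_le_norm _).trans (hf w)
  have h2 := mul_le_mul_of_nonneg_left (hT w) (sq_nonneg t)
  have hX : 0 ≤ ‖ι w‖ := norm_nonneg _
  have hY : 0 ≤ t * ‖D w‖ := by positivity
  have hm : 0 < min 1 c := lt_min one_pos hc
  generalize hYdef : t * ‖D w‖ = b at *
  generalize ‖ι w‖ = a at *
  have h6 : c * b ^ 2 = t ^ 2 * (c * ‖D w‖ ^ 2) := by rw [← hYdef]; ring
  have h3 : min 1 c * (a ^ 2 + b ^ 2) ≤ N * (a + b) := by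
    have h4 := mul_le_mul_of_nonneg_right (min_le_left 1 c) (sq_nonneg a)
    have h5 := mul_le_mul_of_nonneg_right (min_le_right 1 c) (sq_nonneg b)
    linarith
  -- The factor 2 comes from `(a + b)² ≤ 2 (a² + b²)`; dividing by `a + b` then bounds the whole
  -- scaled norm, and in particular `a`.
  have h4 : min 1 c * (a + b) ^ 2 ≤ 2 * N * (a + b) := by
    nlinarith [mul_nonneg hm.le (sq_nonneg (a - b))]
  rw [div_mul_eq_mul_div, le_div_iff₀ hm]
  by_contra! hlt
  have h5 : 2 * N < min 1 c * (a + b) := by nlinarith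
  have h7 : 0 < a + b := by
    by_contra! h
    nlinarith
  nlinarith

/-- For symmetric `T`, the smoothing operators `(1 + t² T)⁻¹` are bounded on `V` uniformly
in `t`. -/
lemma norm_sq_inverse_shifted_le [CompleteSpace V] (hE : ∀ f v, E f v = inner ℂ (ι v) f)
    (hV : ∀ u, ‖u‖ ^ 2 = ‖ι u‖ ^ 2 + ‖D u‖ ^ 2) (hT : ∀ u, ‖D u‖ ^ 2 ≤ (T u u).re)
    (hsymm : ∀ u v, T v u = conj (T u v)) {t : ℝ} (ht : 0 < t) (u : V) :
    ‖(shifted ι E T t).inverse (E (ι u))‖ ^ 2 ≤ (1 + ‖T‖) * ‖u‖ ^ 2 := by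
  set w := (shifted ι E T t).inverse (E (ι u)) with hw
  have hspec := inverse_shifted_spec hE
    (isInvertible_shifted hE hV one_pos (by simpa using hT) ht) (E (ι u))
  -- Testing with `w` bounds `‖ι w‖` by `‖ι u‖`. Testing with `u - w` gives `t² Re T w (u - w) = ‖ι
  -- (u - w)‖² ≥ 0`.
  have h0 := congrArg Complex.re (hspec w)
  have h1 := congrArg Complex.re (hspec (u - w))
  rw [← hw, Complex.add_re, re_sq_mul, hE] at h0 h1
  rw [re_inner_self_eq] at h0
  have h2 : (inner ℂ (ι w) (ι u)).re ≤ ‖ι w‖ * ‖ι u‖ :=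
    (Complex.re_le_norm _).trans (norm_inner_le_norm _ _)
  have h3 : (inner ℂ (ι (u - w)) (ι u)).re - (inner ℂ (ι (u - w)) (ι w)).re
      = ‖ι (u - w)‖ ^ 2 := by
    rw [← re_inner_self_eq, ← Complex.sub_re, ← inner_sub_right, ← map_sub]
  have h4 : 0 ≤ (T w (u - w)).re := by
    have : 0 ≤ t ^ 2 * (T w (u - w)).re := by
      have := sq_nonneg ‖ι (u - w)‖
      linarith
    exact nonneg_of_mul_nonneg_right this (by positivity)
  have hpos : ∀ v : V, 0 ≤ (T v v).re := fun v => (sq_nonneg _).trans (hT v)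
  -- By symmetry the two mixed terms in the expansion of `T u u` around `w` have the same
  -- nonnegative real part, so the energy of `w` is at most that of `u`.
  have h5 : (T w w).re ≤ (T u u).re := by
    have hu : T u u = T w w + T w (u - w) + T (u - w) w + T (u - w) (u - w) := by
      simp only [map_sub, sub_apply]
      ring
    rw [hu, hsymm w (u - w)]
    simp only [Complex.add_re, Complex.conj_re]
    have := hpos (u - w)
    linarith
  have h6 : (T u u).re ≤ ‖T‖ * ‖u‖ ^ 2 := by
    refine (Complex.re_le_norm _).trans (((T u).le_opNorm u).trans ?_)
    have := mul_le_mul_of_nonneg_right (T.le_opNorm u) (norm_nonneg u)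
    rwa [mul_assoc, ← sq] at this
  have h7 : ‖ι w‖ ^ 2 ≤ ‖ι u‖ ^ 2 := by
    have := mul_nonneg (sq_nonneg t) (hpos w)
    nlinarith [sq_nonneg (‖ι w‖ - ‖ι u‖)]
  have h8 : ‖ι u‖ ^ 2 ≤ ‖u‖ ^ 2 := by
    rw [hV]
    linarith [sq_nonneg ‖D u‖]
  rw [hV w]
  linarith [hT w]

lemma exists_norm_inverse_shifted_le [CompleteSpace V] (hE : ∀ f v, E f v = inner ℂ (ι v) f)
    (hV : ∀ u, ‖u‖ ^ 2 = ‖ι u‖ ^ 2 + ‖D u‖ ^ 2) (hT : ∀ u, ‖D u‖ ^ 2 ≤ (T u u).re)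
    (hsymm : ∀ u v, T v u = conj (T u v)) : ∃ L : ℝ, 0 ≤ L ∧ ∀ t : ℝ, 0 < t → ∀ u,
      ‖(shifted ι E T t).inverse (E (ι u))‖ ≤ L * ‖u‖ := by
  refine ⟨√(1 + ‖T‖), by positivity, fun t ht u => ?_⟩
  rw [← Real.sqrt_sq (norm_nonneg u), ← Real.sqrt_mul (by positivity)]
  exact Real.le_sqrt_of_sq_le (norm_sq_inverse_shifted_le hE hV hT hsymm ht u)

/-- Decay of the resolvent on functionals with subcritical scaling. -/
lemma norm_smul_inverse_shifted_le [CompleteSpace V] (hE : ∀ f v, E f v = inner ℂ (ι v) f)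
    (hV : ∀ u, ‖u‖ ^ 2 = ‖ι u‖ ^ 2 + ‖D u‖ ^ 2) {c : ℝ} (hc : 0 < c)
    (hT : ∀ u, c * ‖D u‖ ^ 2 ≤ (T u u).re) {t : ℝ} (ht : 0 < t) {f : AntiDual V} {Q α : ℝ}
    (hQ : 0 ≤ Q) (hf : ∀ v, ‖f v‖ ≤ Q * t ^ (α - 1) * (‖ι v‖ + t * ‖D v‖)) :
    ‖(t : ℂ) • ι ((shifted ι E T t).inverse f)‖ ≤ 2 / min 1 c * Q * t ^ α := by
  rw [norm_smul, Complex.norm_of_nonneg ht.le]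
  refine (mul_le_mul_of_nonneg_left (norm_inverse_shifted_le hE hV hc hT ht (by positivity) hf)
    ht.le).trans (le_of_eq ?_)
  have h3 : t ^ α = t ^ (α - 1) * t := by
    rw [← Real.rpow_add_one ht.ne', sub_add_cancel]
  rw [h3]
  ring

lemma continuousOn_smul_inverse_shifted [CompleteSpace V] {T' : V →L[ℂ] AntiDual V} {s : Set ℝ}
    (h : ∀ t ∈ s, (shifted ι E T t).IsInvertible) (h' : ∀ t ∈ s, (shifted ι E T' t).IsInvertible)
    (S : V →L[ℂ] AntiDual V) (y : AntiDual V) :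
    ContinuousOn (fun t : ℝ => (t : ℂ) • ι ((shifted ι E T t).inverse
      (S ((shifted ι E T' t).inverse y)))) s :=
  Complex.continuous_ofReal.continuousOn.smul (ι.continuous.comp_continuousOn
    ((continuousOn_inverse_shifted h).clm_apply (S.continuous.comp_continuousOn
      ((continuousOn_inverse_shifted h').clm_apply continuousOn_const))))

end Resolvent

/-! ### Completeness of the Sobolev space -/

section Complete

variable {n : ℕ} {D : Set (Pt n)}

lemma continuous_integral_smul {ψ : Pt n → ℝ} (hc : Continuous ψ) (hs : HasCompactSupport ψ) :
    Continuous fun f : Lp ℂ 2 (volume.restrict D) => ∫ x in D, ψ x • f x := by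
  have hψ : MemLp (fun x => (ψ x : ℂ)) 2 (volume.restrict D) :=
    (hc.memLp_of_hasCompactSupport (p := 2) (μ := volume.restrict D) hs).ofReal
  have h : (fun f : Lp ℂ 2 (volume.restrict D) => ∫ x in D, ψ x • f x)
      = fun f => inner ℂ hψ.toLp f := by
    ext f
    rw [L2.inner_def]
    refine integral_congr_ae ?_
    filter_upwards [hψ.coeFn_toLp] with x hx
    rw [hx, RCLike.inner_apply, Complex.conj_ofReal, Complex.real_smul, mul_comm]
  rw [h]
  fun_prop

/-- Each test function imposes an equation between functionals that are continuous in `L²`.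
Closedness makes `W^{1,2}(D)` a Hilbert space, as Lax–Milgram requires. -/
lemma isClosed_sobolevSubmodule : IsClosed (sobolevSubmodule D : Set
    (WithLp 2 (Lp ℂ 2 (volume.restrict D) × Lp (Vec n) 2 (volume.restrict D)))) := by
  have h : (sobolevSubmodule D : Set
      (WithLp 2 (Lp ℂ 2 (volume.restrict D) × Lp (Vec n) 2 (volume.restrict D)))) =
      {w | IsWeakGradient D w.fst w.snd} := rfl
  rw [h]
  simp only [IsWeakGradient, ofPred_forall]
  refine isClosed_iInter fun φ => isClosed_iInter fun h1 => isClosed_iInter fun h2 =>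
    isClosed_iInter fun _ => isClosed_iInter fun i => isClosed_eq ?_ ?_
  · exact (continuous_integral_smul (continuous_partial h1 _) (hasCompactSupport_partial h2 _)).comp
      (WithLp.fstL 2 ℂ _ _).continuous
  · refine Continuous.neg ?_
    have h3 := (continuous_integral_smul (D := D) h1.continuous h2).comp
      ((((EuclideanSpace.proj (𝕜 := ℂ) i : Vec n →L[ℂ] ℂ).compLpL 2 (volume.restrict D))
        ∘L WithLp.sndL 2 ℂ (Lp ℂ 2 (volume.restrict D)) (Lp (Vec n) 2 (volume.restrict D))).continuous)
    refine h3.congr fun w => integral_congr_ae ?_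
    filter_upwards [(EuclideanSpace.proj (𝕜 := ℂ) i : Vec n →L[ℂ] ℂ).coeFn_compLp w.snd] with x hx
    exact congrArg (φ x • ·) hx

instance completeSpace_sobolevSubmodule : CompleteSpace (sobolevSubmodule D) :=
  isClosed_sobolevSubmodule.completeSpace_coe

end Complete

/-! ### Distance to the boundary and chains along curves -/

section Chain

variable {n : ℕ}

/-- The ball is connected, meets `D` and misses the frontier, so it cannot leave `D`. -/
lemma ball_subset_of_le_infDist {D : Set (Pt n)} (hD : IsOpen D) {z : Pt n} (hz : z ∈ D) {r : ℝ}
    (hr : r ≤ Metric.infDist z (frontier D)) : Metric.ball z r ⊆ D := by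
  rcases le_or_gt r 0 with h0 | h0
  · rw [Metric.ball_eq_empty.2 h0]; exact empty_subset _
  refine (convex_ball z r).isPreconnected.subset_left_of_subset_union hD
    isClosed_closure.isOpen_compl (disjoint_compl_right_iff_subset.2 subset_closure) ?_
    ⟨z, Metric.mem_ball_self h0, hz⟩
  intro y hy
  by_cases hyD : y ∈ D
  · exact Or.inl hyD
  · refine Or.inr fun hyc => ?_
    have hyf : y ∈ frontier D := by
      rw [hD.frontier_eq]; exact ⟨hyc, hyD⟩
    have := Metric.infDist_le_dist_of_mem (x := z) hyf
    rw [Metric.mem_ball'] at hy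
    linarith

/-- A function which is Lipschitz continuous at a uniform scale along a rectifiable curve. -/
lemma dist_le_of_lipschitz_near_curve {X E : Type*} [PseudoMetricSpace X] [PseudoMetricSpace E]
    {p : ℝ → X} (hp : ContinuousOn p (Icc 0 1)) {u : X → E} {s L l : ℝ} (hs : 0 < s) (hL : 0 ≤ L)
    (hl : 0 ≤ l) (hlen : eVariationOn p (Icc 0 1) ≤ ENNReal.ofReal l)
    (hu : ∀ t ∈ Icc (0 : ℝ) 1, ∀ y ∈ Metric.ball (p t) s, dist (u y) (u (p t)) ≤ L * dist y (p t)) :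
    dist (u (p 0)) (u (p 1)) ≤ L * l := by
  obtain ⟨δ, hδ, h⟩ := Metric.uniformContinuousOn_iff.1
    (isCompact_Icc.uniformContinuousOn_of_continuous hp) s hs
  obtain ⟨N, hN⟩ := exists_nat_one_div_lt hδ
  -- Equidistant partition so fine that consecutive curve points are closer than `s`. Truncation at
  -- 1 makes it a monotone sequence on all of `ℕ`, as the variation requires.
  set τ : ℕ → ℝ := fun i => min 1 (i / (N + 1 : ℝ)) with hτ
  have hN0 : (0 : ℝ) < N + 1 := by positivity
  have hτ_mem : ∀ i, τ i ∈ Icc (0 : ℝ) 1 := fun i =>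
    ⟨le_min zero_le_one (by positivity), min_le_left _ _⟩
  have hτ_mono : Monotone τ := fun i j hij => by
    refine min_le_min le_rfl ?_
    gcongr
  have hτ_step : ∀ i, dist (τ (i + 1)) (τ i) < δ := by
    intro i
    rw [Real.dist_eq, abs_of_nonneg (sub_nonneg.2 (hτ_mono i.le_succ))]
    have h1 : ((i + 1 : ℕ) : ℝ) / (N + 1) = i / (N + 1) + 1 / (N + 1) := by
      push_cast; ring
    have h2 : τ (i + 1) ≤ τ i + 1 / (N + 1) := by
      simp only [hτ, h1]
      have : (0 : ℝ) ≤ 1 / (N + 1) := by positivity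
      rcases min_cases 1 ((i : ℝ) / (N + 1)) with h | h <;>
      rcases min_cases 1 ((i : ℝ) / (N + 1) + 1 / (N + 1)) with h' | h' <;> linarith
    linarith
  have h1 : edist (u (p (τ 0))) (u (p (τ (N + 1)))) ≤
      ∑ i ∈ Finset.range (N + 1), edist (u (p (τ i))) (u (p (τ (i + 1)))) :=
    edist_le_range_sum_edist (fun i => u (p (τ i))) (N + 1)
  have h2 : ∀ i ∈ Finset.range (N + 1), edist (u (p (τ i))) (u (p (τ (i + 1)))) ≤
      ENNReal.ofReal L * edist (p (τ (i + 1))) (p (τ i)) := by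
    intro i _
    have := hu (τ i) (hτ_mem i) (p (τ (i + 1))) (h _ (hτ_mem _) _ (hτ_mem _) (hτ_step i))
    rw [edist_comm, edist_dist, edist_dist, ← ENNReal.ofReal_mul hL]
    exact ENNReal.ofReal_le_ofReal this
  have h3 := h1.trans (Finset.sum_le_sum h2)
  rw [← Finset.mul_sum] at h3
  have h4 := h3.trans (mul_le_mul_right ((eVariationOn.sum_le hτ_mono hτ_mem).trans hlen) _)
  have h0 : τ 0 = 0 := by simp [hτ]
  have h5 : τ (N + 1) = 1 := by
    simp only [hτ]
    push_cast
    rw [div_self hN0.ne', min_self]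
  rw [h0, h5, ← ENNReal.ofReal_mul hL, edist_dist,
    ENNReal.ofReal_le_ofReal_iff (by positivity)] at h4
  exact h4

end Chain

/-! ### Mollification of functions with a weak gradient -/

section Mollification

variable {n : ℕ}

/-- A smooth bump function supported in the ball of radius `r`. -/
noncomputable def bump (n : ℕ) {r : ℝ} (hr : 0 < r) : ContDiffBump (0 : Pt n) :=
  ⟨r / 2, r, by positivity, by linarith⟩

/-- The mollification of `F` at scale `r`. -/
noncomputable def moll {r : ℝ} (hr : 0 < r) (F : Pt n → ℂ) : Pt n → ℂ :=
  convolution ((bump n hr).normed volume) F (ContinuousLinearMap.lsmul ℝ ℝ) volume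

/-- The constant in the bound for mollifiers. -/
noncomputable def mollConst (n : ℕ) : ℝ := 2 ^ n / volume.real (Metric.ball (0 : Pt n) 1)

lemma measureReal_unitBall_pos : 0 < volume.real (Metric.ball (0 : Pt n) 1) :=
  ENNReal.toReal_pos (Metric.measure_ball_pos volume _ one_pos).ne' measure_ball_lt_top.ne

lemma mollConst_pos : 0 < mollConst n := div_pos (by positivity) measureReal_unitBall_pos

/-- The bump equals 1 on the ball of radius `r / 2`, whence the factor `2 ^ n` in `mollConst`. -/
lemma bump_normed_le {r : ℝ} (hr : 0 < r) (y : Pt n) :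
    (bump n hr).normed volume y ≤ mollConst n * (r ^ n)⁻¹ := by
  refine ((bump n hr).normed_le_div_measure_closedBall_rIn volume y).trans (le_of_eq ?_)
  have h : volume.real (Metric.closedBall (0 : Pt n) (r / 2))
      = (r / 2) ^ n * volume.real (Metric.ball (0 : Pt n) 1) := by
    rw [Measure.addHaar_real_closedBall _ _ (by positivity), finrank_euclideanSpace_fin]
  change 1 / volume.real (Metric.closedBall (0 : Pt n) (r / 2)) = _
  rw [h, mollConst, div_pow]
  have := (measureReal_unitBall_pos (n := n)).ne'
  field_simp

lemma bump_normed_eq_zero {r : ℝ} (hr : 0 < r) {y : Pt n} (hy : r ≤ ‖y‖) :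
    (bump n hr).normed volume y = 0 := by
  have h : y ∉ Function.support ((bump n hr).normed volume) := by
    rw [ContDiffBump.support_normed_eq, mem_ball_zero_iff]
    exact not_lt.2 hy
  simpa using h

lemma moll_eq {r : ℝ} (hr : 0 < r) (F : Pt n → ℂ) (z : Pt n) :
    moll hr F z = ∫ y, (bump n hr).normed volume (z - y) • F y := by
  rw [moll, convolution_lsmul_swap]

/-- Averages with a bump are bounded by averages over balls. -/
lemma norm_integral_bump_smul_le {E : Type*} [NormedAddCommGroup E] [NormedSpace ℝ E]
    {r : ℝ} (hr : 0 < r) {D : Set (Pt n)} {F : Pt n → E}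
    (hF : IntegrableOn F D) {z : Pt n} {B : Set (Pt n)} (hB : MeasurableSet B)
    (hzB : Metric.ball z r ⊆ B) :
    ‖∫ y in D, (bump n hr).normed volume (z - y) • F y‖
      ≤ mollConst n * (r ^ n)⁻¹ * ∫ y in D ∩ B, ‖F y‖ := by
  have hi : ∫ y in D ∩ B, ‖F y‖ = ∫ y in D, B.indicator (fun y => ‖F y‖) y := by
    rw [setIntegral_indicator hB]
  rw [hi, ← integral_const_mul]
  refine norm_integral_le_of_norm_le ((hF.norm.indicator hB).const_mul _)
    (Filter.Eventually.of_forall fun y => ?_)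
  by_cases hy : y ∈ B
  · rw [indicator_of_mem hy, norm_smul, Real.norm_of_nonneg ((bump n hr).nonneg_normed _)]
    exact mul_le_mul_of_nonneg_right (bump_normed_le hr _) (norm_nonneg _)
  · have hz : r ≤ ‖z - y‖ := by
      by_contra! h
      exact hy (hzB (by rwa [Metric.mem_ball', dist_eq_norm]))
    rw [bump_normed_eq_zero hr hz, zero_smul, norm_zero, indicator_of_notMem hy, mul_zero]

lemma moll_indicator_eq {r : ℝ} (hr : 0 < r) {D : Set (Pt n)} (hD : MeasurableSet D)
    (f : Pt n → ℂ) (z : Pt n) :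
    moll hr (D.indicator f) z = ∫ y in D, (bump n hr).normed volume (z - y) • f y := by
  rw [moll_eq, ← integral_indicator hD]
  congr 1
  ext y
  by_cases hy : y ∈ D <;> simp [hy]

/-- Mollifications of functions with a weak gradient are differentiable in the interior. -/
lemma exists_hasFDerivAt_moll {D : Set (Pt n)} (hD : MeasurableSet D) {f : Pt n → ℂ}
    {g : Pt n → Vec n} (hf : IntegrableOn f D) (hg : IntegrableOn g D)
    (hfg : IsWeakGradient D f g) {r : ℝ} (hr : 0 < r) {z : Pt n}
    (hz : Metric.closedBall z r ⊆ D) {B : Set (Pt n)} (hB : MeasurableSet B)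
    (hzB : Metric.ball z r ⊆ B) :
    ∃ L : Pt n →L[ℝ] ℂ, HasFDerivAt (moll hr (D.indicator f)) L z ∧
      ‖L‖ ≤ n * (mollConst n * (r ^ n)⁻¹ * ∫ y in D ∩ B, ‖g y‖) := by
  set ρ := (bump n hr).normed volume with hρ
  have hρs : HasCompactSupport ρ := (bump n hr).hasCompactSupport_normed
  have hρc : ContDiff ℝ ((⊤ : ℕ∞) : WithTop ℕ∞) ρ := (bump n hr).contDiff_normed
  have hF : LocallyIntegrable (D.indicator f) := (hf.integrable_indicator hD).locallyIntegrable
  refine ⟨_, hρs.hasFDerivAt_convolution_left (ContinuousLinearMap.lsmul ℝ ℝ)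
    (hρc.of_le (by simp)) hF z, ?_⟩
  set L := (convolution (fderiv ℝ ρ) (D.indicator f)
    ((ContinuousLinearMap.lsmul ℝ ℝ).precompL (Pt n)) volume) z with hL
  set I := mollConst n * (r ^ n)⁻¹ * ∫ y in D ∩ B, ‖g y‖ with hI
  have hI0 : 0 ≤ I := mul_nonneg (mul_nonneg mollConst_pos.le (by positivity))
    (integral_nonneg fun _ => norm_nonneg _)
  have hcoord : ∀ i, ‖L (EuclideanSpace.single i 1)‖ ≤ I := by
    intro i
    -- The derivative falls on the kernel. The reflected kernel is an admissible test function
    -- because its support lies in `closedBall z r ⊆ D`, so the weak gradient can be used.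
    set φ : Pt n → ℝ := fun y => ρ (z - y) with hφ
    have hφc : ContDiff ℝ ((⊤ : ℕ∞) : WithTop ℕ∞) φ := hρc.comp (contDiff_const.sub contDiff_id)
    have hφt : tsupport φ ⊆ Metric.closedBall z r := by
      refine closure_minimal (fun y hy => ?_) Metric.isClosed_closedBall
      rw [Metric.mem_closedBall', dist_eq_norm]
      by_contra! h
      exact hy (bump_normed_eq_zero hr h.le)
    have hφs : HasCompactSupport φ :=
      (isCompact_closedBall z r).of_isClosed_subset (isClosed_tsupport _) hφt
    have hderiv : ∀ y v, fderiv ℝ φ y v = -fderiv ℝ ρ (z - y) v := by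
      intro y v
      have h1 : HasFDerivAt ρ (fderiv ℝ ρ (z - y)) (z - y) :=
        (hρc.differentiable (by simp)).differentiableAt.hasFDerivAt
      have h2 : HasFDerivAt (fun y : Pt n => z - y) (-ContinuousLinearMap.id ℝ (Pt n)) y :=
        (hasFDerivAt_id y).const_sub z
      have h3 : HasFDerivAt φ _ y := h1.comp y h2
      rw [h3.fderiv]
      simp
    have hLv : L (EuclideanSpace.single i 1)
        = ∫ y in D, ρ (z - y) • g y i := by
      have hex : ConvolutionExistsAt (fderiv ℝ ρ) (D.indicator f) z
          ((ContinuousLinearMap.lsmul ℝ ℝ).precompL (Pt n)) volume :=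
        (hρs.fderiv (𝕜 := ℝ)).convolutionExists_left _ (hρc.continuous_fderiv (by simp)) hF z
      have h1 : L (EuclideanSpace.single i 1) = ∫ y, fderiv ℝ ρ (z - y)
          (EuclideanSpace.single i 1) • D.indicator f y := by
        rw [hL, convolution_eq_swap, ContinuousLinearMap.integral_apply]
        · rfl
        · exact hex.integrable_swap
      have h2 := hfg φ hφc hφs (hφt.trans hz) i
      have h3 : ∫ y, fderiv ℝ ρ (z - y) (EuclideanSpace.single i 1) • D.indicator f y
          = -∫ y in D, fderiv ℝ φ y (EuclideanSpace.single i 1) • f y := by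
        rw [← integral_indicator hD, ← integral_neg]
        congr 1
        ext y
        by_cases hy : y ∈ D <;> simp [hy, hderiv]
      rw [h1, h3, h2, neg_neg]
    rw [hLv]
    have hgi : IntegrableOn (fun y => g y i) D :=
      (EuclideanSpace.proj (𝕜 := ℂ) i : Vec n →L[ℂ] ℂ).integrable_comp hg
    refine (norm_integral_bump_smul_le hr hgi hB hzB).trans ?_
    refine mul_le_mul_of_nonneg_left ?_ (mul_nonneg mollConst_pos.le (by positivity))
    exact integral_mono (hgi.mono_set inter_subset_left).norm (hg.mono_set inter_subset_left).norm
      fun y => PiLp.norm_apply_le (g y) i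
  refine ContinuousLinearMap.opNorm_le_bound _ (by positivity) fun v => ?_
  -- Summing the bounds in the `n` coordinate directions costs the factor `n`.
  have hv : v = ∑ i, v i • EuclideanSpace.single i (1 : ℝ) := by
    ext j
    simp [Pi.single_apply]
  have h1 : L v = ∑ i, v i • L (EuclideanSpace.single i (1 : ℝ)) := by
    conv_lhs => rw [hv]
    simp only [map_sum, map_smul]
  change ‖L v‖ ≤ _
  rw [h1]
  calc ‖∑ i, v i • L (EuclideanSpace.single i (1 : ℝ))‖
      ≤ ∑ _i : Fin n, ‖v‖ * I := norm_sum_le_of_le _ fun i _ => by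
        rw [norm_smul]
        exact mul_le_mul (PiLp.norm_apply_le v i) (hcoord i) (norm_nonneg _) (norm_nonneg _)
    _ = n * I * ‖v‖ := by
        rw [Finset.sum_const, Finset.card_univ, Fintype.card_fin, nsmul_eq_mul]; ring

/-- Mollifications are Lipschitz continuous on balls in the interior. -/
lemma dist_moll_le {D : Set (Pt n)} (hD : MeasurableSet D) {f : Pt n → ℂ}
    {g : Pt n → Vec n} (hf : IntegrableOn f D) (hg : IntegrableOn g D)
    (hfg : IsWeakGradient D f g) {r : ℝ} (hr : 0 < r) {z : Pt n} {s : ℝ} (hs : 0 < s)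
    (hz : Metric.ball z (s + r) ⊆ D) {B : Set (Pt n)} (hB : MeasurableSet B)
    (hzB : Metric.ball z (s + r) ⊆ B) {y : Pt n} (hy : y ∈ Metric.ball z s) :
    dist (moll hr (D.indicator f) y) (moll hr (D.indicator f) z)
      ≤ n * (mollConst n * (r ^ n)⁻¹ * ∫ y in D ∩ B, ‖g y‖) * dist y z := by
  have hsub : ∀ w ∈ Metric.ball z s, Metric.closedBall w r ⊆ Metric.ball z (s + r) := by
    intro w hw
    refine fun v hv => ?_
    rw [Metric.mem_ball] at hw ⊢
    rw [Metric.mem_closedBall] at hv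
    linarith [dist_triangle v w z]
  have h : ∀ w ∈ Metric.ball z s, ∃ L : Pt n →L[ℝ] ℂ,
      HasFDerivAt (moll hr (D.indicator f)) L w ∧
      ‖L‖ ≤ n * (mollConst n * (r ^ n)⁻¹ * ∫ y in D ∩ B, ‖g y‖) := fun w hw =>
    exists_hasFDerivAt_moll hD hf hg hfg hr ((hsub w hw).trans hz) hB
      (Metric.ball_subset_closedBall.trans ((hsub w hw).trans hzB))
  rw [dist_eq_norm, dist_eq_norm]
  refine (convex_ball z s).norm_image_sub_le_of_norm_fderiv_le (𝕜 := ℝ) (fun w hw => ?_)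
    (fun w hw => ?_) (Metric.mem_ball_self hs) hy
  · obtain ⟨L, hL, -⟩ := h w hw
    exact hL.differentiableAt
  · obtain ⟨L, hL, hL'⟩ := h w hw
    rwa [hL.fderiv]

/-- Associativity of convolution, together with commutativity of the convolution of the two kernels.
-/
lemma moll_comm {F : Pt n → ℂ} (hF : Integrable F) {r s : ℝ} (hr : 0 < r) (hs : 0 < s) (c : Pt n) :
    moll hr (moll hs F) c = moll hs (moll hr F) c := by
  have key : ∀ {r s : ℝ} (hr : 0 < r) (hs : 0 < s),
      moll hr (moll hs F) c = convolution (convolution ((bump n hr).normed volume)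
        ((bump n hs).normed volume) (ContinuousLinearMap.lsmul ℝ ℝ) volume) F
        (ContinuousLinearMap.lsmul ℝ ℝ) volume c := by
    intro r s hr hs
    have hρ : ∀ {r : ℝ} (hr : 0 < r), HasCompactSupport ((bump n hr).normed volume) := fun hr =>
      (bump n hr).hasCompactSupport_normed
    have hρc : ∀ {r : ℝ} (hr : 0 < r), Continuous ((bump n hr).normed volume) := fun hr =>
      (bump n hr).continuous_normed
    have hconv : ∀ x, ConvolutionExistsAt (fun x => ‖(bump n hs).normed volume x‖)
        (fun x => ‖F x‖) x (ContinuousLinearMap.mul ℝ ℝ) volume := fun x =>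
      (hρ hs).norm.convolutionExists_left _ (hρc hs).norm hF.norm.locallyIntegrable x
    refine (convolution_assoc _ _ _ _ (fun x y z => ?_) (hρc hr).aestronglyMeasurable
      (hρc hs).aestronglyMeasurable hF.aestronglyMeasurable
      (Filter.Eventually.of_forall fun y => ?_) (Filter.Eventually.of_forall hconv) ?_).symm
    · simp [mul_assoc]
    · exact (hρ hr).convolutionExists_left _ (hρc hr) (hρc hs).locallyIntegrable y
    · refine (hρ hr).norm.convolutionExists_left _ (hρc hr).norm ?_ c
      exact ((hρ hs).norm.continuous_convolution_left _ (hρc hs).norm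
        hF.norm.locallyIntegrable).locallyIntegrable
  rw [key, key]
  congr 1
  ext x
  rw [convolution_lsmul_swap, convolution_lsmul]
  simp [mul_comm]

/-- Comparison of the mollifications at two scales. -/
lemma dist_moll_moll_le {F : Pt n → ℂ} (hF : Integrable F) {r s : ℝ} (hr : 0 < r) (hs : 0 < s)
    {c : Pt n} {a b : ℝ}
    (ha : ∀ y ∈ Metric.ball c s, dist (moll hr F y) (moll hr F c) ≤ a)
    (hb : ∀ y ∈ Metric.ball c r, dist (moll hs F y) (moll hs F c) ≤ b) :
    dist (moll hr F c) (moll hs F c) ≤ a + b := by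
  have hcont : ∀ {r : ℝ} (hr : 0 < r), Continuous (moll hr F) := fun hr =>
    (bump n hr).hasCompactSupport_normed.continuous_convolution_left _
      (bump n hr).continuous_normed hF.locallyIntegrable
  -- The double mollification at `c` averages one mollification with the other kernel, in either
  -- order. It is thus close to both, and no Poincaré inequality is needed.
  have h1 : dist (moll hs (moll hr F) c) (moll hr F c) ≤ a :=
    (bump n hs).dist_normed_convolution_le (hcont hr).aestronglyMeasurable ha
  have h2 : dist (moll hr (moll hs F) c) (moll hs F c) ≤ b :=
    (bump n hr).dist_normed_convolution_le (hcont hs).aestronglyMeasurable hb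
  rw [moll_comm hF hr hs] at h2
  exact (dist_triangle_left _ _ _).trans (add_le_add h1 h2)

end Mollification

/-! ### Corkscrews, cigars and the telescoping approximation -/

section LocallyUniform

variable {n : ℕ} {D : Set (Pt n)} {ε : ℝ}

lemma IsCigar.dist_source_le {x y : Pt n} {p : ℝ → Pt n} (hp : IsCigar D ε x y p) (hε : 0 < ε)
    {s : ℝ} (hs : s ∈ Icc (0 : ℝ) 1) : dist (p s) x ≤ ε⁻¹ * dist x y := by
  have h := (eVariationOn.edist_le p hs (left_mem_Icc.2 zero_le_one)).trans hp.length_le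
  rw [hp.source, edist_dist, ENNReal.ofReal_le_ofReal_iff (by positivity)] at h
  exact h

/-- Locally uniform sets have corkscrew points at all small scales. -/
lemma exists_corkscrew {δ c : ℝ≥0∞} (hε : 0 < ε)
    (hcig : ∀ x ∈ D, ∀ y ∈ D, edist x y < δ → ∃ p : ℝ → Pt n, IsCigar D ε x y p)
    (hcomp : ∀ x ∈ D, c ≤ Metric.ediam (connectedComponentIn D x))
    {x : Pt n} (hx : x ∈ closure D) {h : ℝ} (hh : 0 < h) (hδ : ENNReal.ofReal h < δ)
    (hc : 2 * ENNReal.ofReal h < c) :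
    ∃ z ∈ D, dist z x ≤ h ∧ ε * h / 4 ≤ Metric.infDist z (frontier D) := by
  obtain ⟨a, haD, hax⟩ := Metric.mem_closure_iff.1 hx (h / 4) (by positivity)
  have haS : a ∈ connectedComponentIn D a := mem_connectedComponentIn haD
  -- Otherwise the component of `a` would lie in a ball of diameter at most `2h < c`.
  have hfar : ∃ b ∈ connectedComponentIn D a, h ≤ dist b a := by
    by_contra! hb
    have hsub : connectedComponentIn D a ⊆ Metric.eball a (ENNReal.ofReal h) := fun b hbS => by
      rw [Metric.mem_eball, edist_dist]
      exact (ENNReal.ofReal_lt_ofReal_iff hh).2 (hb b hbS)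
    exact absurd ((hcomp a haD).trans ((Metric.ediam_mono hsub).trans Metric.ediam_eball_le))
      (not_le.2 hc)
  obtain ⟨b₀, hb₀, hb₀h⟩ := hfar
  obtain ⟨b, hbS, hb⟩ := isPreconnected_connectedComponentIn.intermediate_value haS hb₀
    (f := fun y => dist y a) (by fun_prop) ⟨by simpa using hh.le, hb₀h⟩
  have hbD : b ∈ D := connectedComponentIn_subset _ _ hbS
  have hab : dist a b = h := by rw [dist_comm]; exact hb
  obtain ⟨p, hp⟩ := hcig a haD b hbD (by rwa [edist_dist, hab])
  -- The point of the cigar at distance `h / 2` from `a` is also at least `h / 2` from `b`, so the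
  -- cigar condition gives clearance `ε (h/2)² / h`.
  obtain ⟨s, hs, hsh⟩ := intermediate_value_Icc (zero_le_one' ℝ)
    (f := fun s => dist (p s) a) (by have := hp.continuousOn; fun_prop) (show h / 2 ∈ _ by
      simp only [hp.source, hp.target, dist_self, hb]
      exact ⟨by positivity, by linarith⟩)
  simp only at hsh
  refine ⟨p s, hp.mapsTo hs, ?_, ?_⟩
  · linarith [dist_triangle (p s) a x, dist_comm x a]
  · refine le_trans ?_ (hp.le_infDist s hs)
    have hsb : h / 2 ≤ dist (p s) b := by
      linarith [dist_triangle_left a b (p s)]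
    rw [hab, hsh, le_div_iff₀ hh]
    calc ε * h / 4 * h = ε * (h / 2) * (h / 2) := by ring
      _ ≤ ε * (h / 2) * dist (p s) b := by gcongr

/-- Cigars between points far from the boundary stay away from the boundary. -/
lemma IsCigar.le_infDist_of_le {x y : Pt n} {p : ℝ → Pt n} (hp : IsCigar D ε x y p) (hε : 0 < ε)
    (hε1 : ε ≤ 1) {m h : ℝ} (hm : 0 < m) (hm1 : m ≤ 1) (hh : 0 < h) (hxy : dist x y ≤ 2 * h)
    (hx : m * h ≤ Metric.infDist x (frontier D)) (hy : m * h ≤ Metric.infDist y (frontier D))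
    {s : ℝ} (hs : s ∈ Icc (0 : ℝ) 1) :
    ε * m ^ 2 / 8 * h ≤ Metric.infDist (p s) (frontier D) := by
  have hsmall : ε * m ^ 2 / 8 * h ≤ m * h / 2 := by
    have : ε * m ^ 2 ≤ 1 * (1 * m) := by rw [sq]; gcongr
    nlinarith
  have hlip : ∀ w, Metric.infDist w (frontier D) ≤ Metric.infDist (p s) (frontier D)
      + dist (p s) w := fun w => by
    rw [dist_comm]; exact Metric.infDist_le_infDist_add_dist
  -- Near an endpoint the clearance is inherited, since the distance to the boundary is 1-Lipschitz.
  -- Away from both endpoints the cigar condition gives `ε (m h / 2)² / (2h)`.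
  rcases lt_or_ge (dist (p s) x) (m * h / 2) with h1 | h1
  · linarith [hlip x]
  rcases lt_or_ge (dist (p s) y) (m * h / 2) with h2 | h2
  · linarith [hlip y]
  have h0 : 0 < dist x y := by
    by_contra! h0
    have h3 := hp.dist_source_le hε hs
    have : ε⁻¹ * dist x y ≤ 0 := mul_nonpos_of_nonneg_of_nonpos (by positivity) h0
    have : 0 < m * h := by positivity
    linarith
  refine le_trans ?_ (hp.le_infDist s hs)
  rw [le_div_iff₀ h0]
  calc ε * m ^ 2 / 8 * h * dist x y ≤ ε * m ^ 2 / 8 * h * (2 * h) := by gcongr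
    _ = ε * (m * h / 2) * (m * h / 2) := by ring
    _ ≤ ε * dist (p s) x * dist (p s) y := by gcongr

/-- Comparison of mollifications along a cigar. -/
lemma IsCigar.dist_moll_le (hD : IsOpen D) {f : Pt n → ℂ} {g : Pt n → Vec n}
    (hf : IntegrableOn f D) (hg : IntegrableOn g D) (hfg : IsWeakGradient D f g)
    (hε : 0 < ε) {θ h h' : ℝ} (hθ : 0 < θ) (hθ1 : θ ≤ 1) (hh : 0 < h)
    (hh' : h' = h / 2) {x c c' : Pt n} {p : ℝ → Pt n} (hp : IsCigar D ε c c' p)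
    (hcc : dist c c' ≤ 2 * h) (hcx : dist c x ≤ h)
    (hclear : ∀ s ∈ Icc (0 : ℝ) 1, θ * h ≤ Metric.infDist (p s) (frontier D))
    (hr : 0 < θ * h / 4) (hr' : 0 < θ * h' / 4) :
    dist (moll hr (D.indicator f) c) (moll hr' (D.indicator f) c')
      ≤ n * mollConst n * ((θ / 8) ^ n)⁻¹ * (2 / ε + 1) *
        (h * (h ^ n)⁻¹ * ∫ y in D ∩ Metric.ball x ((2 / ε + 3) * h), ‖g y‖) := by
  set B := Metric.ball x ((2 / ε + 3) * h) with hB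
  set I := ∫ y in D ∩ B, ‖g y‖ with hI
  have hI0 : 0 ≤ I := integral_nonneg fun _ => norm_nonneg _
  -- Curve points are within `(2/ε) h` of `c`, hence within `(2/ε + 1) h` of `x`; the radius `(2/ε +
  -- 3) h` leaves room for the small balls.
  have hDB : ∀ s ∈ Icc (0 : ℝ) 1, Metric.ball (p s) (θ * h / 2) ⊆ D ∩ B := by
    intro s hs
    refine subset_inter ((Metric.ball_subset_ball (by nlinarith)).trans
      (ball_subset_of_le_infDist hD (hp.mapsTo hs) (hclear s hs))) ?_
    refine Metric.ball_subset_ball' ?_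
    have h1 : dist (p s) c ≤ 2 / ε * h := (hp.dist_source_le hε hs).trans (by
      calc ε⁻¹ * dist c c' ≤ ε⁻¹ * (2 * h) := by gcongr
        _ = 2 / ε * h := by ring)
    have h2 := dist_triangle (p s) c x
    nlinarith
  set Λ := n * (mollConst n * ((θ * h / 8) ^ n)⁻¹ * I) with hΛ
  have hΛ0 : 0 ≤ Λ := by
    have := (mollConst_pos (n := n)).le
    positivity
  -- One Lipschitz constant serves both kernels, of radii `θ h / 4` and `θ h / 8`; this is why `Λ`
  -- is built with the smaller one.
  have hlip : ∀ {r : ℝ} (hr : 0 < r), θ * h / 8 ≤ r → r ≤ θ * h / 4 → ∀ s ∈ Icc (0 : ℝ) 1,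
      ∀ y ∈ Metric.ball (p s) (θ * h / 4),
        dist (moll hr (D.indicator f) y) (moll hr (D.indicator f) (p s)) ≤ Λ * dist y (p s) := by
    intro r hr hr1 hr2 s hs y hy
    have hsub : Metric.ball (p s) (θ * h / 4 + r) ⊆ D ∩ B :=
      (Metric.ball_subset_ball (by linarith)).trans (hDB s hs)
    refine (RobinKato.dist_moll_le hD.measurableSet hf hg hfg hr (by positivity)
      (hsub.trans inter_subset_left) Metric.isOpen_ball.measurableSet
      (hsub.trans inter_subset_right) hy).trans ?_
    have := (mollConst_pos (n := n)).le
    rw [hΛ, hI]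
    gcongr
  have h1 : dist (moll hr (D.indicator f) c) (moll hr (D.indicator f) c') ≤ Λ * (2 / ε * h) := by
    have := dist_le_of_lipschitz_near_curve hp.continuousOn (s := θ * h / 4) (by positivity) hΛ0
      (l := 2 / ε * h) (by positivity) (hp.length_le.trans (ENNReal.ofReal_le_ofReal (by
        calc ε⁻¹ * dist c c' ≤ ε⁻¹ * (2 * h) := by gcongr
          _ = 2 / ε * h := by ring))) (hlip hr (by linarith) le_rfl)
    rwa [hp.source, hp.target] at this
  have h1mem : (1 : ℝ) ∈ Icc (0 : ℝ) 1 := right_mem_Icc.2 zero_le_one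
  have hF : Integrable (D.indicator f) := hf.integrable_indicator hD.measurableSet
  have h2 : dist (moll hr (D.indicator f) c') (moll hr' (D.indicator f) c')
      ≤ Λ * (θ * h / 4) + Λ * (θ * h / 4) := by
    refine dist_moll_moll_le hF hr hr' (fun y hy => ?_) fun y hy => ?_
    · have hy' : y ∈ Metric.ball (p 1) (θ * h / 4) := by
        rw [hp.target]
        exact Metric.ball_subset_ball (by rw [hh']; nlinarith) hy
      have := hlip hr (by linarith) le_rfl 1 h1mem y hy'
      rw [hp.target] at this hy'
      exact this.trans (mul_le_mul_of_nonneg_left (Metric.mem_ball.1 hy').le hΛ0)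
    · have hy' : y ∈ Metric.ball (p 1) (θ * h / 4) := by rwa [hp.target]
      have := hlip hr' (by rw [hh']; linarith) (by rw [hh']; nlinarith) 1 h1mem y hy'
      rw [hp.target] at this hy'
      exact this.trans (mul_le_mul_of_nonneg_left (Metric.mem_ball.1 hy').le hΛ0)
  have h3 : Λ * (θ * h / 4) ≤ Λ * h / 2 := by
    have : θ * h ≤ 1 * h := by gcongr
    nlinarith
  have h4 : n * mollConst n * ((θ / 8) ^ n)⁻¹ * (2 / ε + 1) * (h * (h ^ n)⁻¹ * I)
      = Λ * (2 / ε * h) + Λ * h := by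
    have h5 : ((θ * h / 8) ^ n)⁻¹ = ((θ / 8) ^ n)⁻¹ * (h ^ n)⁻¹ := by
      rw [← mul_inv, ← mul_pow]; congr 2; ring
    rw [hΛ, h5]
    ring
  rw [h4]
  linarith [dist_triangle (moll hr (D.indicator f) c) (moll hr (D.indicator f) c')
    (moll hr' (D.indicator f) c')]

lemma tendsto_moll {f : Pt n → ℂ} (hDm : MeasurableSet D) (hf : ContinuousOn f (closure D))
    (hfi : IntegrableOn f D) {x : Pt n}
    (hx : x ∈ closure D) {r : ℕ → ℝ} (hr : ∀ j, 0 < r j) {c : ℕ → Pt n} (hc : ∀ j, c j ∈ D)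
    (hr0 : Filter.Tendsto r Filter.atTop (𝓝 0)) (hcx : Filter.Tendsto c Filter.atTop (𝓝 x))
    (hrD : ∀ j, Metric.ball (c j) (r j) ⊆ D) :
    Filter.Tendsto (fun j => moll (hr j) (D.indicator f) (c j)) Filter.atTop (𝓝 (f x)) := by
  rw [Metric.tendsto_atTop]
  intro e he
  obtain ⟨ρ, hρ, hρf⟩ := Metric.continuousWithinAt_iff.1 (hf x hx) (e / 4) (by positivity)
  obtain ⟨N₁, hN₁⟩ := Metric.tendsto_atTop.1 hr0 (ρ / 2) (by positivity)
  obtain ⟨N₂, hN₂⟩ := Metric.tendsto_atTop.1 hcx (ρ / 2) (by positivity)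
  refine ⟨max N₁ N₂, fun j hj => ?_⟩
  have h1 := hN₁ j ((le_max_left _ _).trans hj)
  have h2 := hN₂ j ((le_max_right _ _).trans hj)
  rw [Real.dist_0_eq_abs, abs_of_pos (hr j)] at h1
  have h3 : dist (f (c j)) (f x) < e / 4 :=
    hρf (subset_closure (hc j)) (h2.trans (by linarith))
  have h4 : dist (moll (hr j) (D.indicator f) (c j)) (D.indicator f (c j)) ≤ e / 2 := by
    refine (bump n (hr j)).dist_normed_convolution_le
      (hfi.integrable_indicator hDm).aestronglyMeasurable fun y hy => ?_
    have hyD : y ∈ D := hrD j hy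
    have hyc : dist y (c j) < r j := hy
    rw [indicator_of_mem hyD, indicator_of_mem (hc j)]
    have h5 : dist (f y) (f x) < e / 4 :=
      hρf (subset_closure hyD) (by linarith [dist_triangle y (c j) x])
    linarith [dist_triangle_right (f y) (f (c j)) (f x)]
  rw [indicator_of_mem (hc j)] at h4
  linarith [dist_triangle (moll (hr j) (D.indicator f) (c j)) (f (c j)) (f x)]

/-- In locally uniform sets, the values of Sobolev functions that are continuous up to the boundary
are limits of sequences whose increments are controlled by averages of the gradient. -/
lemma IsLocallyUniform.exists_approx (hU : IsLocallyUniform D) (hD : IsOpen D) :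
    ∃ C R h₀ : ℝ, 0 < C ∧ 0 < R ∧ 0 < h₀ ∧ ∀ (f : Pt n → ℂ) (g : Pt n → Vec n),
      IntegrableOn f D → IntegrableOn g D → IsWeakGradient D f g → ContinuousOn f (closure D) →
      ∀ x ∈ closure D, ∀ h : ℝ, 0 < h → h ≤ h₀ → ∃ F : ℕ → ℂ,
        Filter.Tendsto F Filter.atTop (𝓝 (f x)) ∧
        ‖F 0‖ ≤ C * ((h ^ n)⁻¹ * ∫ y in D ∩ Metric.ball x (R * h), ‖f y‖) ∧
        ∀ j, dist (F j) (F (j + 1)) ≤ C * (h / 2 ^ j * ((h / 2 ^ j) ^ n)⁻¹ *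
          ∫ y in D ∩ Metric.ball x (R * (h / 2 ^ j)), ‖g y‖) := by
  obtain ⟨ε, hε, hε1, δ, hδ, c, hc, hcig, hcomp⟩ := hU
  -- Consecutive corkscrew points are at most `2h` apart, which must stay below `δ`; finding them
  -- requires `2h < c`.
  obtain ⟨h₀, hh₀, hh₀'⟩ : ∃ h₀ : ℝ, 0 < h₀ ∧ 2 * ENNReal.ofReal h₀ < min δ c := by
    obtain ⟨a, ha, ha'⟩ := ENNReal.lt_iff_exists_nnreal_btwn.1 (lt_min hδ hc)
    refine ⟨a / 2, by have := ENNReal.coe_pos.1 ha; positivity, ?_⟩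
    rw [show (2 : ℝ≥0∞) = ENNReal.ofReal 2 by simp, ← ENNReal.ofReal_mul zero_le_two,
      mul_div_cancel₀ _ two_ne_zero, ENNReal.ofReal_coe_nnreal]
    exact ha'
  -- Clearance of the cigars from `IsCigar.le_infDist_of_le` with `m = ε / 8`: at scale `η` the two
  -- corkscrew points have clearance `ε η / 4` and, for the next scale `η / 2`, `ε η / 8`.
  set θ := ε * (ε / 8) ^ 2 / 8 with hθdef
  have hθ : 0 < θ := by positivity
  have hθε : θ ≤ ε / 8 := by
    rw [hθdef]
    have : (ε / 8) ^ 2 ≤ 1 := by nlinarith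
    nlinarith
  have hθ1 : θ ≤ 1 := by linarith
  have hM := mollConst_pos (n := n)
  set C₁ := n * mollConst n * ((θ / 8) ^ n)⁻¹ * (2 / ε + 1) with hC₁
  set C₂ := mollConst n * ((θ / 4) ^ n)⁻¹ with hC₂
  have hC₁0 : 0 ≤ C₁ := by positivity
  have hC₂0 : 0 < C₂ := by positivity
  refine ⟨C₁ + C₂, 2 / ε + 3, h₀, by positivity, by positivity, hh₀, ?_⟩
  intro f g hf hg hfg hfc x hx h hh hhh
  set η : ℕ → ℝ := fun j => h / 2 ^ j with hη
  have hη0 : ∀ j, 0 < η j := fun j => by positivity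
  have hηh : ∀ j, η j ≤ h₀ := fun j => (div_le_self hh.le (one_le_pow₀ one_le_two)).trans hhh
  have hη1 : ∀ j, η (j + 1) = η j / 2 := fun j => by simp only [hη, pow_succ]; ring
  have hηlim : Filter.Tendsto η Filter.atTop (𝓝 0) :=
    tendsto_const_nhds.div_atTop (tendsto_pow_atTop_atTop_of_one_lt one_lt_two)
  have hsmall : ∀ j, 2 * ENNReal.ofReal (η j) < min δ c := fun j =>
    lt_of_le_of_lt (by gcongr; exact hηh j) hh₀'
  have hcork : ∀ j, ∃ z ∈ D, dist z x ≤ η j ∧ ε * η j / 4 ≤ Metric.infDist z (frontier D) :=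
    fun j => exists_corkscrew hε hcig hcomp hx (hη0 j)
      (lt_of_le_of_lt (by rw [two_mul]; exact le_self_add)
        ((hsmall j).trans_le (min_le_left _ _)))
      ((hsmall j).trans_le (min_le_right _ _))
  choose z hzD hzx hzf using hcork
  have hr : ∀ j, 0 < θ * η j / 4 := fun j => by have := hη0 j; positivity
  refine ⟨fun j => moll (hr j) (D.indicator f) (z j), ?_, ?_, ?_⟩
  · refine tendsto_moll hD.measurableSet hfc hf hx hr hzD ?_ ?_ fun j => ?_
    · simpa using (hηlim.const_mul θ).div_const 4
    · exact tendsto_iff_dist_tendsto_zero.2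
        (squeeze_zero (fun _ => dist_nonneg) hzx hηlim)
    · refine ball_subset_of_le_infDist hD (hzD j) (le_trans ?_ (hzf j))
      have := hη0 j
      gcongr
      linarith
  · have hη00 : η 0 = h := by simp [hη]
    simp only
    rw [moll_indicator_eq _ hD.measurableSet]
    refine (norm_integral_bump_smul_le (hr 0) hf
      (B := Metric.ball x ((2 / ε + 3) * h)) Metric.isOpen_ball.measurableSet ?_).trans ?_
    · refine Metric.ball_subset_ball' ?_
      have h1 := hzx 0
      rw [hη00] at h1 ⊢
      have : 0 < 2 / ε * h := by positivity
      nlinarith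
    · have hI : 0 ≤ (h ^ n)⁻¹ * ∫ y in D ∩ Metric.ball x ((2 / ε + 3) * h), ‖f y‖ :=
        mul_nonneg (by positivity) (integral_nonneg fun _ => norm_nonneg _)
      have h5 : ((θ * η 0 / 4) ^ n)⁻¹ = ((θ / 4) ^ n)⁻¹ * (h ^ n)⁻¹ := by
        rw [hη00, ← mul_inv, ← mul_pow]; congr 2; ring
      rw [h5, hC₂, ← mul_assoc (mollConst n), mul_assoc _ (h ^ n)⁻¹]
      exact mul_le_mul_of_nonneg_right (le_add_of_nonneg_left hC₁0) hI
  · intro j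
    have hzz : dist (z j) (z (j + 1)) ≤ 2 * η j := by
      have h1 := hzx (j + 1)
      rw [hη1] at h1
      linarith [hη0 j, hzx j, dist_triangle_right (z j) (z (j + 1)) x]
    obtain ⟨p, hp⟩ := hcig (z j) (hzD j) (z (j + 1)) (hzD (j + 1)) (by
      rw [edist_dist]
      refine (ENNReal.ofReal_le_ofReal hzz).trans_lt ?_
      rw [ENNReal.ofReal_mul zero_le_two, ENNReal.ofReal_ofNat]
      exact (hsmall j).trans_le (min_le_left _ _))
    have hclear : ∀ s ∈ Icc (0 : ℝ) 1, θ * η j ≤ Metric.infDist (p s) (frontier D) := fun s hs =>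
      hp.le_infDist_of_le hε hε1 (m := ε / 8) (by positivity) (by linarith) (hη0 j) hzz
        (by nlinarith [hzf j, hη0 j]) (by have := hzf (j + 1); rw [hη1] at this; linarith) hs
    refine (hp.dist_moll_le hD hf hg hfg hε hθ hθ1 (hη0 j) (hη1 j) hzz (hzx j) hclear
      (hr j) (hr (j + 1))).trans ?_
    refine mul_le_mul_of_nonneg_right (by linarith) ?_
    have := hη0 j
    exact mul_nonneg (by positivity) (integral_nonneg fun _ => norm_nonneg _)

end LocallyUniform

/-! ### Minkowski's inequality and local integrals against a second measure -/

section Lebesgue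

variable {X : Type*} [MeasurableSpace X] {μ : Measure X}

/-- Minkowski's inequality for finite sums. -/
lemma lintegral_rpow_sum_le {ι : Type*} {a : ι → X → ℝ≥0∞} (ha : ∀ j, Measurable (a j)) {p : ℝ}
    (hp : 1 ≤ p) (t : Finset ι) :
    (∫⁻ x, (∑ j ∈ t, a j x) ^ p ∂μ) ^ (1 / p) ≤ ∑ j ∈ t, (∫⁻ x, a j x ^ p ∂μ) ^ (1 / p) := by
  classical
  have hp0 : 0 < p := one_pos.trans_le hp
  induction t using Finset.induction_on with
  | empty => simp [ENNReal.zero_rpow_of_pos, hp0]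
  | insert i t hi ih =>
    simp only [Finset.sum_insert hi]
    refine (ENNReal.lintegral_Lp_add_le (f := a i) (g := fun x => ∑ j ∈ t, a j x)
      (ha i).aemeasurable (Finset.measurable_sum t fun j _ => ha j).aemeasurable hp).trans ?_
    gcongr

/-- Minkowski's inequality for series. -/
lemma lintegral_rpow_tsum_le {a : ℕ → X → ℝ≥0∞} (ha : ∀ j, Measurable (a j)) {p : ℝ}
    (hp : 1 ≤ p) :
    (∫⁻ x, (∑' j, a j x) ^ p ∂μ) ^ (1 / p) ≤ ∑' j, (∫⁻ x, a j x ^ p ∂μ) ^ (1 / p) := by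
  have hp0 : 0 < p := one_pos.trans_le hp
  have h1 : ∀ x, (∑' j, a j x) ^ p = ⨆ N, (∑ j ∈ Finset.range N, a j x) ^ p := fun x => by
    rw [ENNReal.tsum_eq_iSup_nat]
    exact (ENNReal.orderIsoRpow p hp0).map_iSup _
  have h2 : ∫⁻ x, (∑' j, a j x) ^ p ∂μ = ⨆ N, ∫⁻ x, (∑ j ∈ Finset.range N, a j x) ^ p ∂μ := by
    simp_rw [h1]
    refine lintegral_iSup (fun N => (Finset.measurable_sum _ fun j _ => ha j).pow_const p) ?_
    intro N M hNM x
    exact ENNReal.rpow_le_rpow (Finset.sum_le_sum_of_subset (Finset.range_mono hNM)) hp0.le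
  have h3 := (ENNReal.orderIsoRpow (1 / p) (by positivity)).map_iSup
    fun N => ∫⁻ x, (∑ j ∈ Finset.range N, a j x) ^ p ∂μ
  simp only [ENNReal.orderIsoRpow_apply] at h3
  rw [h2, h3]
  exact iSup_le fun N => (lintegral_rpow_sum_le ha hp _).trans (ENNReal.sum_le_tsum _)

variable [PseudoMetricSpace X] [OpensMeasurableSpace X] [SecondCountableTopology X]

lemma measurable_lintegral_ball [SFinite μ] {g : X → ℝ≥0∞} (hg : Measurable g) (R : ℝ) :
    Measurable fun x => ∫⁻ y in Metric.ball x R, g y ∂μ := by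
  have hS : MeasurableSet {p : X × X | dist p.2 p.1 < R} :=
    measurableSet_lt (measurable_snd.dist measurable_fst) measurable_const
  have h : (fun x => ∫⁻ y in Metric.ball x R, g y ∂μ) = fun x =>
      ∫⁻ y, {p : X × X | dist p.2 p.1 < R}.indicator (fun p => g p.2) (x, y) ∂μ := by
    ext x
    rw [← lintegral_indicator Metric.isOpen_ball.measurableSet]
    rfl
  rw [h]
  exact ((hg.comp measurable_snd).indicator hS).lintegral_prod_right'

/-- Local integrals, measured with respect to a second measure with small balls. -/
lemma lintegral_lintegral_ball_rpow_le {ν : Measure X} [SFinite μ] [SFinite ν] {g : X → ℝ≥0∞}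
    (hg : Measurable g) {R : ℝ} {N : ℝ≥0∞} (hν : ∀ y, ν (Metric.ball y R) ≤ N) {p : ℝ}
    (hp : 1 ≤ p) :
    ∫⁻ x, (∫⁻ y in Metric.ball x R, g y ∂μ) ^ p ∂ν ≤ N * (∫⁻ y, g y ∂μ) ^ p := by
  set T := ∫⁻ y, g y ∂μ with hT
  have hpow : ∀ m : ℝ≥0∞, m ^ p = m * m ^ (p - 1) := fun m => by
    have h := ENNReal.rpow_add_of_nonneg (x := m) 1 (p - 1) zero_le_one (sub_nonneg.2 hp)
    rwa [ENNReal.rpow_one, add_sub_cancel] at h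
  -- The case `p = 1` is Tonelli. The general case follows by bounding `p - 1` of the factors by the
  -- total integral `T`.
  have h1 : ∫⁻ x, ∫⁻ y in Metric.ball x R, g y ∂μ ∂ν ≤ N * T := by
    have hS : MeasurableSet {p : X × X | dist p.2 p.1 < R} :=
      measurableSet_lt (measurable_snd.dist measurable_fst) measurable_const
    calc ∫⁻ x, ∫⁻ y in Metric.ball x R, g y ∂μ ∂ν
        = ∫⁻ x, ∫⁻ y, {p : X × X | dist p.2 p.1 < R}.indicator (fun p => g p.2) (x, y) ∂μ ∂ν := by
          refine lintegral_congr fun x => ?_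
          rw [← lintegral_indicator Metric.isOpen_ball.measurableSet]
          rfl
      _ = ∫⁻ y, ∫⁻ x, {p : X × X | dist p.2 p.1 < R}.indicator (fun p => g p.2) (x, y) ∂ν ∂μ :=
          lintegral_lintegral_swap ((hg.comp measurable_snd).indicator hS).aemeasurable
      _ = ∫⁻ y, g y * ν (Metric.ball y R) ∂μ := by
          refine lintegral_congr fun y => ?_
          rw [← setLIntegral_const, ← lintegral_indicator Metric.isOpen_ball.measurableSet]
          refine lintegral_congr fun x => ?_
          simp only [indicator, mem_ofPred_eq, Metric.mem_ball, dist_comm y x]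
      _ ≤ ∫⁻ y, N * g y ∂μ := lintegral_mono fun y => by
          rw [mul_comm]
          gcongr
          exact hν y
      _ = N * T := lintegral_const_mul _ hg
  calc ∫⁻ x, (∫⁻ y in Metric.ball x R, g y ∂μ) ^ p ∂ν
      ≤ ∫⁻ x, (∫⁻ y in Metric.ball x R, g y ∂μ) * T ^ (p - 1) ∂ν := by
        refine lintegral_mono fun x => ?_
        rw [hpow]
        exact mul_le_mul_right (ENNReal.rpow_le_rpow (setLIntegral_le_lintegral _ _)
          (sub_nonneg.2 hp)) _
    _ = (∫⁻ x, ∫⁻ y in Metric.ball x R, g y ∂μ ∂ν) * T ^ (p - 1) :=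
        lintegral_mul_const _ (measurable_lintegral_ball hg R)
    _ ≤ N * T * T ^ (p - 1) := by gcongr
    _ = N * T ^ p := by rw [hpow T, mul_assoc]

end Lebesgue

/-! ### Averages over balls centred on the boundary part -/

section Trace

variable {n : ℕ}

/-- The Cauchy–Schwarz inequality on balls. -/
lemma ofReal_integral_ball_le {E : Type*} [NormedAddCommGroup E] {D : Set (Pt n)} {g : Pt n → E}
    (hg : IntegrableOn g D) (x : Pt n) {R : ℝ} (hR : 0 < R) :
    ENNReal.ofReal (∫ y in D ∩ Metric.ball x R, ‖g y‖) ≤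
      ENNReal.ofReal (volume.real (Metric.ball (0 : Pt n) 1) ^ (1 / 2 : ℝ) * R ^ ((n : ℝ) / 2)) *
        (∫⁻ y in Metric.ball x R, ‖g y‖ₑ ^ (2 : ℝ) ∂(volume.restrict D)) ^ (1 / 2 : ℝ) := by
  have hB : MeasurableSet (Metric.ball x R) := Metric.isOpen_ball.measurableSet
  rw [ofReal_integral_norm_eq_lintegral_enorm (hg.mono_set inter_subset_left), inter_comm,
    ← Measure.restrict_restrict hB]
  set ν := (volume.restrict D).restrict (Metric.ball x R) with hν
  have h1 := ENNReal.lintegral_mul_le_Lp_mul_Lq ν Real.HolderConjugate.two_two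
    (f := fun y => ‖g y‖ₑ) (g := fun _ => 1) (hg.aestronglyMeasurable.mono_measure
      Measure.restrict_le_self).enorm aemeasurable_const
  simp only [Pi.mul_apply, mul_one, ENNReal.one_rpow, lintegral_const, one_mul] at h1
  refine h1.trans ?_
  rw [mul_comm]
  gcongr
  have h2 : ν univ ≤ ENNReal.ofReal (volume.real (Metric.ball (0 : Pt n) 1) * R ^ n) := by
    rw [hν, Measure.restrict_apply_univ]
    refine (Measure.restrict_apply_le _ _).trans ?_
    rw [Measure.addHaar_ball_of_pos _ _ hR, finrank_euclideanSpace_fin, mul_comm (volume.real _),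
      ENNReal.ofReal_mul (by positivity), ofReal_measureReal measure_ball_lt_top.ne]
  refine (ENNReal.rpow_le_rpow h2 (by norm_num)).trans (le_of_eq ?_)
  rw [ENNReal.ofReal_rpow_of_nonneg (by positivity) (by norm_num),
    Real.mul_rpow (by positivity) (by positivity), ← Real.rpow_natCast, ← Real.rpow_mul hR.le]
  congr 3
  ring

lemma inv_pow_mul_rpow {R h : ℝ} (hR : 0 ≤ R) (hh : 0 < h) :
    (h ^ n)⁻¹ * (R * h) ^ ((n : ℝ) / 2) = R ^ ((n : ℝ) / 2) * h ^ (-(n : ℝ) / 2) := by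
  rw [Real.mul_rpow hR hh.le, ← Real.rpow_natCast h n, ← Real.rpow_neg hh.le, mul_left_comm,
    ← Real.rpow_add hh]
  congr 2
  ring

namespace Domain

variable (G : Domain n)

lemma d_pos : 0 < G.d := by
  have h1 := G.lt_d
  have h2 : (2 : ℝ) ≤ n := by exact_mod_cast G.two_le
  linarith

/-- The `d`-set condition concerns centres in `Γ`. A ball with any other centre that meets `Γ` lies
in a ball of twice the radius centred there, hence `2 * R ≤ 1`. -/
lemma exists_σ_ball_le : ∃ c : ℝ, 0 < c ∧ ∀ (y : Pt n) (R : ℝ), 0 < R → 2 * R ≤ 1 →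
    G.σ (Metric.ball y R) ≤ ENNReal.ofReal (c * R ^ G.d) := by
  obtain ⟨c, hc, -, h⟩ := G.isDSet
  refine ⟨c⁻¹ * 2 ^ G.d, by positivity, fun y R hR hR1 => ?_⟩
  rw [Measure.restrict_apply Metric.isOpen_ball.measurableSet]
  rcases (Metric.ball y R ∩ G.Γ).eq_empty_or_nonempty with he | ⟨x, hxy, hx⟩
  · rw [he, measure_empty]; exact zero_le
  · have hsub : Metric.ball y R ∩ G.Γ ⊆ G.Γ ∩ Metric.ball x (2 * R) := by
      rintro z ⟨hz, hzΓ⟩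
      refine ⟨hzΓ, ?_⟩
      rw [Metric.mem_ball] at *
      linarith [dist_triangle_right z x y]
    refine (measure_mono hsub).trans ((h x hx (2 * R) (by positivity) hR1).2.trans (le_of_eq ?_))
    rw [Real.mul_rpow zero_le_two hR.le, mul_assoc]

/-- `L^p(Γ)`-bounds for local `L²`-averages. -/
lemma exists_lintegral_ball_le {p : ℝ} (hp : 2 ≤ p) : ∃ c : ℝ, 0 < c ∧
    ∀ (g : Pt n → ℝ≥0∞), Measurable g → ∀ (K R : ℝ), 0 ≤ K → 0 < R → 2 * R ≤ 1 →
      (∫⁻ x, (ENNReal.ofReal K * (∫⁻ y in Metric.ball x R, g y ^ (2 : ℝ) ∂G.vol) ^ (1 / 2 : ℝ)) ^ p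
          ∂G.σ) ^ (1 / p) ≤
        ENNReal.ofReal (c * (K * R ^ (G.d / p))) *
          (∫⁻ y, g y ^ (2 : ℝ) ∂G.vol) ^ (1 / 2 : ℝ) := by
  obtain ⟨c, hc, h⟩ := G.exists_σ_ball_le
  have hp0 : 0 < p := by linarith
  refine ⟨c ^ (1 / p), by positivity, fun g hg K R hK hR hR1 => ?_⟩
  have hm := (measurable_lintegral_ball (μ := G.vol) (hg.pow_const (2 : ℝ)) R)
  have h1 : ∀ x, (ENNReal.ofReal K *
      (∫⁻ y in Metric.ball x R, g y ^ (2 : ℝ) ∂G.vol) ^ (1 / 2 : ℝ)) ^ p =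
      ENNReal.ofReal K ^ p * (∫⁻ y in Metric.ball x R, g y ^ (2 : ℝ) ∂G.vol) ^ (p / 2) := by
    intro x
    rw [ENNReal.mul_rpow_of_nonneg _ _ hp0.le, ← ENNReal.rpow_mul]
    congr 2
    ring
  have hpp : p * (1 / p) = 1 := mul_one_div_cancel hp0.ne'
  have h2 : p / 2 * (1 / p) = 1 / 2 := by field_simp
  simp_rw [h1]
  rw [lintegral_const_mul _ (hm.pow_const _), ENNReal.mul_rpow_of_nonneg _ _ (by positivity),
    ← ENNReal.rpow_mul, hpp, ENNReal.rpow_one]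
  -- Applied with exponent `p / 2` to the square of `g`; this is where `p ≥ 2` enters.
  have h3 := lintegral_lintegral_ball_rpow_le (μ := G.vol) (ν := G.σ) (hg.pow_const (2 : ℝ))
    (fun y => h y R hR hR1) (p := p / 2) (by linarith)
  have h4 := ENNReal.rpow_le_rpow h3 (z := 1 / p) (by positivity)
  rw [ENNReal.mul_rpow_of_nonneg _ _ (by positivity), ← ENNReal.rpow_mul, h2,
    ENNReal.ofReal_rpow_of_nonneg (by positivity) (by positivity),
    Real.mul_rpow hc.le (by positivity), ← Real.rpow_mul hR.le, mul_one_div] at h4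
  refine (mul_le_mul_right h4 _).trans (le_of_eq ?_)
  rw [← mul_assoc, ← ENNReal.ofReal_mul hK]
  congr 2
  ring

end Domain

end Trace

namespace Domain

variable {n : ℕ} (G : Domain n)

/-! ### The trace inequality with scaling -/

section TraceEstimate

lemma integrableOn_of_memLp_two {E : Type*} [NormedAddCommGroup E] (f : Lp E 2 G.vol) :
    IntegrableOn f G.D :=
  (Lp.memLp f).integrable one_le_two

lemma rpow_lintegral_eq_norm {E : Type*} [NormedAddCommGroup E] (f : Lp E 2 G.vol) :
    (∫⁻ y, ‖f y‖ₑ ^ (2 : ℝ) ∂G.vol) ^ (1 / 2 : ℝ) = ENNReal.ofReal ‖f‖ := by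
  rw [Lp.norm_def, ENNReal.ofReal_toReal (Lp.eLpNorm_ne_top f), eLpNorm_eq_lintegral_rpow_enorm_toReal two_ne_zero ENNReal.ofNat_ne_top]
  simp

lemma isWeakGradient_contRep (u : G.contSubmodule) :
    IsWeakGradient G.D (G.contRep u) (G.grad u) := by
  intro φ h1 h2 h3 i
  have h := u.1.2 φ h1 h2 h3 i
  refine Eq.trans (integral_congr_ae ?_) h
  filter_upwards [G.contRep_ae u] with x hx
  rw [← hx]
  rfl

/-- The pointwise estimate of a Sobolev function on the boundary by averages at all scales. -/
lemma exists_enorm_le : ∃ C R h₀ : ℝ, 0 < C ∧ 0 < R ∧ 0 < h₀ ∧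
    ∀ (f : Pt n → ℂ) (F : Lp ℂ 2 G.vol) (g : Lp (Vec n) 2 G.vol), ContinuousOn f (closure G.D) →
      F =ᵐ[G.vol] f → IsWeakGradient G.D f g → ∀ x ∈ closure G.D, ∀ h : ℝ, 0 < h → h ≤ h₀ →
      ‖f x‖ₑ ≤ ENNReal.ofReal (C * h ^ (-(n : ℝ) / 2)) *
          (∫⁻ y in Metric.ball x (R * h), ‖F y‖ₑ ^ (2 : ℝ) ∂G.vol) ^ (1 / 2 : ℝ) +
        ∑' j : ℕ, ENNReal.ofReal (C * (h / 2 ^ j) ^ (1 - (n : ℝ) / 2)) *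
          (∫⁻ y in Metric.ball x (R * (h / 2 ^ j)), ‖g y‖ₑ ^ (2 : ℝ) ∂G.vol)
            ^ (1 / 2 : ℝ) := by
  obtain ⟨C, R, h₀, hC, hR, hh₀, H⟩ := G.isLocallyUniform.exists_approx G.isOpen
  set v := volume.real (Metric.ball (0 : Pt n) 1) ^ (1 / 2 : ℝ) with hv
  have hv0 : 0 < v := Real.rpow_pos_of_pos measureReal_unitBall_pos _
  refine ⟨C * (v * R ^ ((n : ℝ) / 2)), R, h₀, by positivity, hR, hh₀, fun f F g hfc hFf hfg x hx h hh hhh => ?_⟩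
  have hfi : IntegrableOn (f) G.D :=
    (G.integrableOn_of_memLp_two F).congr hFf
  obtain ⟨a, ha, ha0, haj⟩ := H _ _ hfi (G.integrableOn_of_memLp_two g)
    hfg hfc x hx h hh hhh
  have h1 : ‖a 0‖ₑ ≤ ENNReal.ofReal (C * (v * R ^ ((n : ℝ) / 2)) * h ^ (-(n : ℝ) / 2)) *
      (∫⁻ y in Metric.ball x (R * h), ‖F y‖ₑ ^ (2 : ℝ) ∂G.vol) ^ (1 / 2 : ℝ) := by
    have hcongr : ∫ y in G.D ∩ Metric.ball x (R * h), ‖f y‖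
        = ∫ y in G.D ∩ Metric.ball x (R * h), ‖F y‖ := by
      refine integral_congr_ae ?_
      filter_upwards [ae_restrict_of_ae_restrict_of_subset inter_subset_left hFf]
        with y hy
      rw [hy]
    rw [← ofReal_norm]
    refine (ENNReal.ofReal_le_ofReal ha0).trans ?_
    rw [hcongr, ← mul_assoc, ENNReal.ofReal_mul (by positivity)]
    refine (mul_le_mul_right (ofReal_integral_ball_le (G.integrableOn_of_memLp_two F) x
      (R := R * h) (by positivity)) _).trans (le_of_eq ?_)
    rw [← mul_assoc, ← ENNReal.ofReal_mul (by positivity), ← hv]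
    congr 2
    rw [mul_assoc C, mul_left_comm _ v, inv_pow_mul_rpow hR.le hh]
    ring
  have h2 : ∀ j, edist (a j) (a (j + 1)) ≤
      ENNReal.ofReal (C * (v * R ^ ((n : ℝ) / 2)) * (h / 2 ^ j) ^ (1 - (n : ℝ) / 2)) *
        (∫⁻ y in Metric.ball x (R * (h / 2 ^ j)), ‖g y‖ₑ ^ (2 : ℝ) ∂G.vol)
          ^ (1 / 2 : ℝ) := by
    intro j
    have hj : 0 < h / 2 ^ j := by positivity
    rw [edist_dist]
    refine (ENNReal.ofReal_le_ofReal (haj j)).trans ?_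
    generalize h / 2 ^ j = k at *
    rw [← mul_assoc, ENNReal.ofReal_mul (by positivity)]
    refine (mul_le_mul_right (ofReal_integral_ball_le (G.integrableOn_of_memLp_two g) x
      (R := R * k) (by positivity)) _).trans (le_of_eq ?_)
    rw [← mul_assoc, ← ENNReal.ofReal_mul (by positivity), ← hv]
    congr 2
    have hk : k ^ (1 - (n : ℝ) / 2) = k * k ^ (-(n : ℝ) / 2) := by
      rw [neg_div, Real.rpow_neg hj.le, Real.rpow_sub hj, Real.rpow_one, div_eq_mul_inv]
    rw [hk, ← mul_assoc C k, mul_assoc (C * k), mul_left_comm _ v, inv_pow_mul_rpow hR.le hj]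
    ring
  -- Telescoping from scale `h` down to the limit `f x`.
  have h3 := edist_le_tsum_of_edist_le_of_tendsto₀ _ h2 ha
  calc ‖f x‖ₑ ≤ ‖a 0‖ₑ + edist (a 0) (f x) := by
        rw [edist_comm, edist_eq_enorm_sub]
        calc ‖f x‖ₑ = ‖a 0 + (f x - a 0)‖ₑ := by rw [add_sub_cancel]
          _ ≤ _ := enorm_add_le _ _
    _ ≤ _ := add_le_add h1 h3

/-- The trace inequality with scaling, for functions that are continuous up to the boundary. -/
lemma exists_eLpNorm_le {q : ℝ≥0∞} (hq : q ≠ ⊤) (hq2 : 2 ≤ q.toReal)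
    (hα : 0 < 1 - (n : ℝ) / 2 + G.d / q.toReal) :
    ∃ C h₀ : ℝ, 0 < C ∧ 0 < h₀ ∧ ∀ (f : Pt n → ℂ) (F : Lp ℂ 2 G.vol)
      (g : Lp (Vec n) 2 G.vol), ContinuousOn f (closure G.D) →
      F =ᵐ[G.vol] f → IsWeakGradient G.D f g → ∀ h : ℝ, 0 < h → h ≤ h₀ →
      eLpNorm f q G.σ ≤
        ENNReal.ofReal (C * h ^ (1 - (n : ℝ) / 2 + G.d / q.toReal - 1) * ‖F‖ +
          C * h ^ (1 - (n : ℝ) / 2 + G.d / q.toReal) * ‖g‖) := by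
  obtain ⟨C, R, h₀, hC, hR, hh₀, H⟩ := G.exists_enorm_le
  obtain ⟨c, hc, Hc⟩ := G.exists_lintegral_ball_le hq2
  have hq0 : q ≠ 0 := by rintro rfl; norm_num at hq2
  set p := q.toReal with hp
  set α := 1 - (n : ℝ) / 2 + G.d / p with hαdef
  have hp1 : 1 ≤ p := by linarith
  -- Ratio of the geometric series: passing from `h / 2^j` to the next scale multiplies the bound by
  -- `2^(-α)`.
  set θ : ℝ := (1 / 2) ^ α with hθ
  have hθ0 : 0 ≤ θ := by positivity
  have hθ1 : θ < 1 := Real.rpow_lt_one (by norm_num) (by norm_num) hα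
  have hθi : 1 ≤ (1 - θ)⁻¹ := (one_le_inv₀ (by linarith)).2 (by linarith)
  set C₂ := c * C * R ^ (G.d / p) with hC₂
  have hC₂0 : 0 < C₂ := by positivity
  -- The bound `1 / (2 * R)` keeps all balls small enough for the `d`-set estimate.
  refine ⟨C₂ * (1 - θ)⁻¹, min h₀ (1 / (2 * R)), by positivity, by positivity,
    fun f F g hfc hFf hfg h hh hhh => ?_⟩
  have hRh : ∀ k, 0 < k → k ≤ h → 2 * (R * k) ≤ 1 := by
    intro k _ hkh
    have h1 : k ≤ 1 / (2 * R) := hkh.trans (hhh.trans (min_le_right _ _))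
    rw [le_div_iff₀ (by positivity)] at h1
    linarith
  have hF : Measurable fun y => ‖F y‖ₑ := (Lp.stronglyMeasurable F).enorm
  have hgm : Measurable fun y => ‖g y‖ₑ := (Lp.stronglyMeasurable g).enorm
  have hmeas : ∀ {g : Pt n → ℝ≥0∞}, Measurable g → ∀ (K : ℝ≥0∞) (r : ℝ),
      Measurable fun x => K * (∫⁻ y in Metric.ball x r, g y ^ (2 : ℝ) ∂G.vol) ^ (1 / 2 : ℝ) :=
    fun hg K r => ((measurable_lintegral_ball (μ := G.vol) (hg.pow_const (2 : ℝ)) r).pow_const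
      _).const_mul K
  have hη0 : ∀ j : ℕ, 0 < h / 2 ^ j := fun j => by positivity
  have hηh : ∀ j : ℕ, h / 2 ^ j ≤ h := fun j => div_le_self hh.le (one_le_pow₀ one_le_two)
  have hexp : ∀ (k e : ℝ), 0 < k →
      c * (C * k ^ e * (R * k) ^ (G.d / p)) = C₂ * k ^ (e + G.d / p) := by
    intro k e hk
    rw [Real.mul_rpow hR.le hk.le, Real.rpow_add hk, hC₂]
    ring
  rw [eLpNorm_eq_lintegral_rpow_enorm_toReal hq0 hq, ENNReal.ofReal_add (by positivity)
    (by positivity), ENNReal.ofReal_mul' (norm_nonneg F), ENNReal.ofReal_mul' (norm_nonneg g)]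
  have h1 : ∫⁻ x, ‖f x‖ₑ ^ p ∂G.σ ≤ ∫⁻ x,
      (ENNReal.ofReal (C * h ^ (-(n : ℝ) / 2)) *
          (∫⁻ y in Metric.ball x (R * h), ‖F y‖ₑ ^ (2 : ℝ) ∂G.vol) ^ (1 / 2 : ℝ) +
        ∑' j : ℕ, ENNReal.ofReal (C * (h / 2 ^ j) ^ (1 - (n : ℝ) / 2)) *
          (∫⁻ y in Metric.ball x (R * (h / 2 ^ j)), ‖g y‖ₑ ^ (2 : ℝ) ∂G.vol)
            ^ (1 / 2 : ℝ)) ^ p ∂G.σ := by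
    refine lintegral_mono_ae ?_
    filter_upwards [ae_restrict_mem G.measurableSet] with x hx
    exact ENNReal.rpow_le_rpow
      (H f F g hfc hFf hfg x (G.subset_closure hx) h hh (hhh.trans (min_le_left _ _))) (by linarith)
  refine (ENNReal.rpow_le_rpow h1 (by positivity)).trans
    ((ENNReal.lintegral_Lp_add_le (hmeas hF _ _).aemeasurable
      (Measurable.tsum fun j => hmeas hgm _ _).aemeasurable hp1).trans
    (add_le_add ?_ ((lintegral_rpow_tsum_le (fun j => hmeas hgm _ _) hp1).trans ?_)))
  · refine (Hc _ hF _ (R * h) (by positivity) (by positivity) (hRh h hh le_rfl)).trans ?_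
    rw [G.rpow_lintegral_eq_norm, hexp h _ hh]
    have he : -(n : ℝ) / 2 + G.d / p = α - 1 := by rw [hαdef]; ring
    rw [he]
    refine mul_le_mul_left (ENNReal.ofReal_le_ofReal ?_) _
    exact mul_le_mul_of_nonneg_right (le_mul_of_one_le_right hC₂0.le hθi) (by positivity)
  · have h2 : ∀ j : ℕ, (∫⁻ x, (ENNReal.ofReal (C * (h / 2 ^ j) ^ (1 - (n : ℝ) / 2)) *
          (∫⁻ y in Metric.ball x (R * (h / 2 ^ j)), ‖g y‖ₑ ^ (2 : ℝ) ∂G.vol)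
            ^ (1 / 2 : ℝ)) ^ p ∂G.σ) ^ (1 / p) ≤
        ENNReal.ofReal (C₂ * h ^ α * θ ^ j) * ENNReal.ofReal ‖g‖ := by
      intro j
      refine (Hc _ hgm _ (R * (h / 2 ^ j)) (by positivity) (by positivity)
        (hRh _ (hη0 j) (hηh j))).trans (le_of_eq ?_)
      rw [G.rpow_lintegral_eq_norm, hexp _ _ (hη0 j)]
      congr 2
      rw [mul_assoc C₂]
      congr 1
      rw [← hαdef, hθ, Real.rpow_pow_comm (by norm_num), ← Real.mul_rpow hh.le (by positivity),
        one_div, inv_pow, div_eq_mul_inv]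
    refine (ENNReal.tsum_le_tsum h2).trans ?_
    rw [ENNReal.tsum_mul_right, ← ENNReal.ofReal_tsum_of_nonneg (fun j => by positivity)
      ((summable_geometric_of_lt_one hθ0 hθ1).mul_left _), tsum_mul_left,
      tsum_geometric_of_lt_one hθ0 hθ1]
    refine le_of_eq ?_
    congr 2
    ring

/-- Estimates pass to the extension by density of a linear map. -/
lemma norm_extendOfNorm_subtype_le {V W : Type*} [NormedAddCommGroup V] [NormedSpace ℂ V]
    [NormedAddCommGroup W] [NormedSpace ℂ W] [CompleteSpace W] {S : Submodule ℂ V}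
    (f : S →ₗ[ℂ] W) {N : V → ℝ} (hN : Continuous N) (hN0 : ∀ v, 0 ≤ N v) {K : ℝ}
    (hNK : ∀ v, N v ≤ K * ‖v‖) (hf : ∀ v : S, ‖f v‖ ≤ N v) (v : V) :
    ‖f.extendOfNorm S.subtype v‖ ≤ N v := by
  by_cases hdense : DenseRange S.subtype
  · refine hdense.induction (P := fun v => ‖f.extendOfNorm S.subtype v‖ ≤ N v) ?_
      (isClosed_le (f.extendOfNorm S.subtype).continuous.norm hN) v
    rintro _ ⟨u, rfl⟩
    rw [LinearMap.extendOfNorm_eq hdense ⟨K, fun u => (hf u).trans (hNK u)⟩]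
    exact hf u
  -- If the range is not dense, the extension is zero by definition and the bound is trivial.
  -- Density of the functions continuous up to the boundary is thus not needed.
  · have h : ¬ (DenseRange (LinearMap.range S.subtype).subtypeL ∧
        IsUniformInducing (LinearMap.range S.subtype).subtypeL) := by
      rintro ⟨h1, -⟩
      refine hdense ?_
      rw [DenseRange] at h1 ⊢
      simpa using h1
    rw [LinearMap.extendOfNorm, ContinuousLinearMap.extend, dif_neg h,
      zero_apply, norm_zero]
    exact hN0 v

lemma scaled_add_le {C a t α X Y : ℝ} (hC : 0 ≤ C) (ha : 0 < a) (ht : 0 < t) (hX : 0 ≤ X)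
    (hY : 0 ≤ Y) : C * (a * t) ^ (α - 1) * X + C * (a * t) ^ α * Y ≤
      C * (a ^ (α - 1) + a ^ α) * t ^ (α - 1) * (X + t * Y) := by
  have h3 : t ^ α = t ^ (α - 1) * t := by
    rw [← Real.rpow_add_one ht.ne', sub_add_cancel]
  rw [Real.mul_rpow ha.le ht.le, Real.mul_rpow ha.le ht.le, h3]
  have h4 : 0 ≤ C * a ^ α * t ^ (α - 1) * X := by positivity
  have h5 : 0 ≤ C * a ^ (α - 1) * t ^ (α - 1) * (t * Y) := by positivity
  linarith

/-- The trace inequality with scaling: the trace operator is bounded on `W^{1,2}(D)`, with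
a gain over the scaling of `W^{1,2}(D)`. -/
lemma exists_norm_trace_le {q : ℝ≥0∞} [Fact (1 ≤ q)] (hq : q ≠ ⊤) (hq2 : 2 ≤ q.toReal)
    (hα : 0 < 1 - (n : ℝ) / 2 + G.d / q.toReal) :
    ∃ C : ℝ, 0 < C ∧ ∀ (u : G.W12) (t : ℝ), 0 < t → t ≤ 1 →
      ‖G.trace q u‖ ≤ C * t ^ (1 - (n : ℝ) / 2 + G.d / q.toReal - 1) *
        (‖G.incl u‖ + t * ‖G.grad u‖) := by
  obtain ⟨C, h₀, hC, hh₀, H⟩ := G.exists_eLpNorm_le hq hq2 hα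
  generalize 1 - (n : ℝ) / 2 + G.d / q.toReal = α at *
  obtain ⟨C', hC', hC'0⟩ : ∃ C', C' = C * (h₀ ^ (α - 1) + h₀ ^ α) ∧ 0 < C' :=
    ⟨_, rfl, by positivity⟩
  have hcont : ∀ (u : G.contSubmodule) (t : ℝ), 0 < t → t ≤ 1 →
      ‖G.restrictLinear q u‖ ≤ C' * t ^ (α - 1) * (‖G.incl u‖ + t * ‖G.grad u‖) := by
    intro u t ht ht1
    -- Taking `h = h₀ t` covers every `t ∈ (0, 1]`; the powers of `h₀` go into `C'`.
    have h1 := H _ _ _ (G.continuousOn_contRep u) (G.contRep_ae u) (G.isWeakGradient_contRep u)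
      (h₀ * t) (by positivity) (mul_le_of_le_one_right hh₀.le ht1)
    have h2 : ‖G.restrictLinear q u‖ = (eLpNorm (G.contRep u) q G.σ).toReal :=
      Lp.norm_toLp _ (G.memLp_contRep q u)
    rw [h2]
    rw [hC']
    exact (ENNReal.toReal_le_of_le_ofReal (by positivity) h1).trans
      (scaled_add_le hC.le hh₀ ht (norm_nonneg _) (norm_nonneg _))
  refine ⟨C', hC'0, fun u t ht ht1 => ?_⟩
  refine norm_extendOfNorm_subtype_le (G.restrictLinear q)
    (N := fun u => C' * t ^ (α - 1) * (‖G.incl u‖ + t * ‖G.grad u‖))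
    (K := C' * t ^ (α - 1) * (‖G.incl‖ + t * ‖G.grad‖)) ?_ (fun _ => by positivity) (fun v => ?_)
    (fun v => hcont v t ht ht1) u
  · exact continuous_const.mul (G.incl.continuous.norm.add
      (continuous_const.mul G.grad.continuous.norm))
  · exact (mul_le_mul_of_nonneg_left (add_le_add (G.incl.le_opNorm v)
      (mul_le_mul_of_nonneg_left (G.grad.le_opNorm v) ht.le)) (by positivity)).trans_eq (by ring)

end TraceEstimate

/-! ### Numerology of the exponents -/

section Exponents

/-- The numerology of the exponents: `2 ≤ q < ∞`, and `q` is subcritical for the trace. -/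
lemma exponents {r q q' : ℝ≥0∞} [ENNReal.HolderTriple r q q'] [ENNReal.HolderConjugate q' q]
    (hr : ENNReal.ofReal (G.d / (G.d + 2 - n)) < r) :
    q ≠ ⊤ ∧ 2 ≤ q.toReal ∧ 0 < 1 - (n : ℝ) / 2 + G.d / q.toReal := by
  have hd := G.d_pos
  have hdn : 0 < G.d + 2 - n := by linarith [G.lt_d]
  have h1 : r⁻¹ + q⁻¹ = q'⁻¹ := ENNReal.HolderTriple.inv_add_inv_eq_inv r q q'
  have h2 : q'⁻¹ + q⁻¹ = 1 := ENNReal.HolderConjugate.inv_add_inv_eq_one q' q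
  rw [← h1] at h2
  have hrt : r⁻¹ ≠ ⊤ := fun h => by simp [h] at h2
  have hqt : q⁻¹ ≠ ⊤ := fun h => by simp [h] at h2
  have h3 : r⁻¹.toReal + 2 * q⁻¹.toReal = 1 := by
    have := congrArg ENNReal.toReal h2
    rw [ENNReal.toReal_add (ENNReal.add_ne_top.2 ⟨hrt, hqt⟩) hqt, ENNReal.toReal_add hrt hqt,
      ENNReal.toReal_one] at this
    linarith
  have h4 : r⁻¹.toReal < (G.d + 2 - n) / G.d := by
    have h5 := ENNReal.inv_lt_inv.2 hr
    rw [← ENNReal.ofReal_inv_of_pos (by positivity), inv_div] at h5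
    exact (ENNReal.lt_ofReal_iff_toReal_lt hrt).1 h5
  rw [lt_div_iff₀ hd] at h4
  have hr0 : 0 ≤ r⁻¹.toReal := ENNReal.toReal_nonneg
  -- Multiply `1/r + 2/q = 1` by `d` and insert `d/r < d + 2 - n`. Since `n ≥ 2`, this also excludes
  -- `q = ⊤`.
  have h6 : (n : ℝ) - 2 < 2 * (G.d * q⁻¹.toReal) := by nlinarith
  have hn : (2 : ℝ) ≤ n := by exact_mod_cast G.two_le
  have h7 : 0 < q⁻¹.toReal := by
    by_contra! h
    nlinarith
  have hq : q ≠ ⊤ := by rintro rfl; simp at h7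
  rw [ENNReal.toReal_inv q] at h3 h6 h7
  have hq0 : 0 < q.toReal := inv_pos.1 h7
  refine ⟨hq, ?_, ?_⟩
  · have h8 : q.toReal⁻¹ ≤ 2⁻¹ := by linarith
    exact (inv_le_inv₀ hq0 two_pos).1 h8
  · rw [div_eq_mul_inv G.d]
    linarith

end Exponents

end Domain

namespace Domain

variable {n : ℕ} (G : Domain n)

/-! ### The Robin operator and decay of the boundary term -/

section Operators

lemma inner_toEuclideanCLM_of_eq_one {M : Matrix (Fin n) (Fin n) ℂ} (hM : M = 1) (z w : Vec n) :
    inner ℂ z (Matrix.toEuclideanCLM (n := Fin n) (𝕜 := ℂ) M w) = inner ℂ z w := by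
  rw [hM, map_one]
  rfl

lemma inner_add_integral_symm {H X : Type*} [NormedAddCommGroup H] [InnerProductSpace ℂ H]
    [MeasurableSpace X] {μ : Measure X} (a b : H) (f g : X → ℂ) :
    inner ℂ a b + ∫ x, f x * conj (g x) ∂μ = conj (inner ℂ b a + ∫ x, g x * conj (f x) ∂μ) := by
  rw [map_add, inner_conj_symm, ← integral_conj]
  simp only [map_mul, Complex.conj_conj, mul_comm]

lemma norm_sq_le_re_inner_add_integral {H X : Type*} [NormedAddCommGroup H]
    [InnerProductSpace ℂ H] [MeasurableSpace X] {μ : Measure X} (a : H) (f : X → ℂ) :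
    ‖a‖ ^ 2 ≤ (inner ℂ a a + ∫ x, f x * conj (f x) ∂μ).re := by
  have h : ∫ x, f x * conj (f x) ∂μ = ((∫ x, ‖f x‖ ^ 2 ∂μ : ℝ) : ℂ) := by
    rw [← integral_complex_ofReal]
    refine integral_congr_ae (.of_forall fun x => ?_)
    simp [Complex.mul_conj']
  rw [Complex.add_re, re_inner_self_eq, h, Complex.ofReal_re]
  have : 0 ≤ ∫ x, ‖f x‖ ^ 2 ∂μ := integral_nonneg fun x => sq_nonneg _
  linarith

variable (r q q' : ℝ≥0∞) [Fact (1 ≤ r)] [Fact (1 ≤ q)] [Fact (1 ≤ q')]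
  [ENNReal.HolderTriple r q q'] [ENNReal.HolderConjugate q' q]

lemma laplacian_apply (u v : G.W12) :
    G.laplacian q q' r u v = inner ℂ (G.grad v) (G.grad u) +
      ∫ x, G.trace q u x * conj (G.trace q v x) ∂G.σ := by
  refine (G.robinOp_apply q q' _ _ u v).trans (congrArg₂ (· + ·) ?_ ?_)
  · refine (integral_congr_ae ?_).trans (L2.inner_def _ _).symm
    filter_upwards [Lp.coeFn_const ⊤ G.vol (1 : Matrix (Fin n) (Fin n) ℂ)] with x hx
    exact inner_toEuclideanCLM_of_eq_one hx _ _
  · refine integral_congr_ae ?_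
    filter_upwards [Lp.coeFn_const r G.σ (1 : ℂ)] with x hx
    exact congrArg (· * conj (G.trace q v x)) ((congrArg (· * G.trace q u x) hx).trans (one_mul _))

lemma laplacian_symm (u v : G.W12) :
    G.laplacian q q' r v u = conj (G.laplacian q q' r u v) :=
  (G.laplacian_apply r q q' v u).trans ((inner_add_integral_symm _ _ _ _).trans
    (congrArg conj (G.laplacian_apply r q q' u v).symm))

lemma norm_sq_grad_le_re_laplacian (u : G.W12) :
    ‖G.grad u‖ ^ 2 ≤ (G.laplacian q q' r u u).re :=
  (norm_sq_le_re_inner_add_integral _ _).trans_eq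
    (congrArg Complex.re (G.laplacian_apply r q q' u u).symm)

/-- The smoothing operators are bounded on `W^{1,2}(D)` uniformly in `t`. -/
lemma exists_norm_smoothing_le : ∃ L : ℝ, 0 ≤ L ∧ ∀ t : ℝ, 0 < t → ∀ u : G.W12,
    ‖G.smoothing q q' r t (G.incl u)‖ ≤ L * ‖u‖ :=
  exists_norm_inverse_shifted_le (ι := G.incl) (D := G.grad) (E := G.emb)
    (T := G.laplacian q q' r) (fun _ _ => rfl) G.norm_sq_eq
    (G.norm_sq_grad_le_re_laplacian r q q') (G.laplacian_symm r q q')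

/-- Hölder's inequality with `1/r + 1/q + 1/q = 1`. The constant comes from the norms of the
pairings and does not depend on `b`. -/
lemma exists_norm_traceAdj_mulB_le : ∃ P : ℝ, 0 ≤ P ∧
    ∀ (b : Lp ℂ r G.σ) (g : Lp ℂ q G.σ) (v : G.W12),
      ‖G.traceAdj q q' (G.mulB b g) v‖ ≤ P * (‖b‖ * ‖g‖) * ‖G.trace q v‖ := by
  set H := (ContinuousLinearMap.mul ℂ ℂ).holderL G.σ r q q' with hH
  set B := (ContinuousLinearMap.mul ℂ ℂ).lpPairing G.σ q' q with hB
  refine ⟨‖B‖ * ‖H‖ * ‖G.conjLp q‖, by positivity, fun b g v => ?_⟩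
  calc ‖G.traceAdj q q' (G.mulB b g) v‖
      = ‖B (H b g) (G.conjLp q (G.trace q v))‖ := rfl
    _ ≤ ‖B‖ * ‖H b g‖ * ‖G.conjLp q (G.trace q v)‖ := B.le_opNorm₂ _ _
    _ ≤ ‖B‖ * (‖H‖ * ‖b‖ * ‖g‖) * (‖G.conjLp q‖ * ‖G.trace q v‖) := by
        gcongr
        · exact H.le_opNorm₂ _ _
        · exact (G.conjLp q).le_opNorm _
    _ = _ := by ring

variable {r}

/-- Only the gradient part of the coercivity is kept: the identity in `1 + t² 𝓛` already controls
the `L²` norm. -/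
lemma coercive_robinOp {lam : ℝ} (hlam : 0 < lam) {A : Lp (Matrix (Fin n) (Fin n) ℂ) ⊤ G.vol}
    {b : Lp ℂ r G.σ} (h : ∀ u : G.W12, lam * ‖u‖ ^ 2 ≤ (G.form q A b u u).re) (u : G.W12) :
    lam * ‖G.grad u‖ ^ 2 ≤ (G.robinOp q q' A b u u).re := by
  rw [robinOp_apply]
  refine le_trans (mul_le_mul_of_nonneg_left ?_ hlam.le) (h u)
  rw [G.norm_sq_eq]
  exact le_add_of_nonneg_left (sq_nonneg _)

lemma continuousOn_boundaryTerm {lam : ℝ} (hlam : 0 < lam)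
    {A : Lp (Matrix (Fin n) (Fin n) ℂ) ⊤ G.vol} {b : Lp ℂ r G.σ}
    (h : ∀ u : G.W12, lam * ‖u‖ ^ 2 ≤ (G.form q A b u u).re) (u : G.W12) :
    ContinuousOn (fun t => G.boundaryTerm q q' A b t u) (Ioi 0) := by
  exact continuousOn_smul_inverse_shifted (ι := G.incl) (E := G.emb) (T := G.robinOp q q' A b)
    (T' := G.laplacian q q' r)
    (fun t ht => isInvertible_shifted (D := G.grad) (fun _ _ => rfl) G.norm_sq_eq hlam
      (G.coercive_robinOp q q' hlam h) ht)
    (fun t ht => isInvertible_shifted (D := G.grad) (fun _ _ => rfl) G.norm_sq_eq one_pos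
      (fun u => by rw [one_mul]; exact G.norm_sq_grad_le_re_laplacian r q q' u) ht)
    (G.traceAdj q q' ∘L G.mulB b ∘L G.trace q) (G.emb (G.incl u))

variable (r) in
/-- The boundary term decays like a power of `t`. -/
lemma exists_norm_boundaryTerm_le (hr : ENNReal.ofReal (G.d / (G.d + 2 - n)) < r) {lam : ℝ}
    (hlam : 0 < lam) (K : ℝ) : ∃ α N : ℝ, 0 < α ∧
      ∀ (A : Lp (Matrix (Fin n) (Fin n) ℂ) ⊤ G.vol) (b : Lp ℂ r G.σ), ‖b‖ ≤ K →
        (∀ u : G.W12, lam * ‖u‖ ^ 2 ≤ (G.form q A b u u).re) → ∀ (u : G.W12) (t : ℝ), 0 < t →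
          t ≤ 1 → ‖G.boundaryTerm q q' A b t u‖ ≤ N * ‖u‖ * t ^ α := by
  obtain ⟨hq, hq2, hα⟩ := G.exponents (q := q) (q' := q') hr
  obtain ⟨C, hC, htr⟩ := G.exists_norm_trace_le hq hq2 hα
  obtain ⟨P, hP, hPb⟩ := G.exists_norm_traceAdj_mulB_le r q q'
  obtain ⟨L, hL, hLle⟩ := G.exists_norm_smoothing_le r q q'
  generalize 1 - (n : ℝ) / 2 + G.d / q.toReal = α at *
  refine ⟨α, 2 / min 1 lam * (P * (K * (‖G.trace q‖ * L)) * C), hα,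
    fun A b hb hcoer u t ht ht1 => ?_⟩
  have hK : 0 ≤ K := (norm_nonneg b).trans hb
  have hγ : 0 ≤ ‖G.trace q‖ := (G.trace q).opNorm_nonneg
  have hu : 0 ≤ ‖u‖ := norm_nonneg _
  -- No decay is extracted from this factor. The gain `t ^ α` comes entirely from the trace of the
  -- test function `v`.
  have hg : ‖G.trace q (G.smoothing q q' r t (G.incl u))‖ ≤ ‖G.trace q‖ * (L * ‖u‖) :=
    ((G.trace q).le_opNorm _).trans (mul_le_mul_of_nonneg_left (hLle t ht u) hγ)
  have hQ : 0 ≤ P * (K * (‖G.trace q‖ * (L * ‖u‖))) := by positivity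
  refine (norm_smul_inverse_shifted_le (ι := G.incl) (D := G.grad) (E := G.emb)
    (T := G.robinOp q q' A b) (α := α) (fun _ _ => rfl) G.norm_sq_eq hlam
    (G.coercive_robinOp q q' hlam hcoer) ht (mul_nonneg hQ hC.le) fun v => ?_).trans_eq ?_
  · refine (hPb b _ v).trans ((mul_le_mul (mul_le_mul_of_nonneg_left
      (mul_le_mul hb hg (norm_nonneg _) hK) hP) (htr v t ht ht1) (norm_nonneg _) hQ).trans_eq ?_)
    ring
  · ring

end Operators

end Domain

/-- Square functions with power decay at the origin. -/
lemma integral_sq_div_le {E : Type*} [NormedAddCommGroup E] {f : ℝ → E}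
    (hf : ContinuousOn f (Ioi 0)) {α K : ℝ} (hα : 0 < α)
    (h : ∀ t, 0 < t → t ≤ 1 → ‖f t‖ ≤ K * t ^ α) :
    IntegrableOn (fun t : ℝ => ‖f t‖ ^ 2 / t) (Ioc 0 1) ∧
      ∫ t in Ioc (0 : ℝ) 1, ‖f t‖ ^ 2 / t ≤ K ^ 2 / (2 * α) := by
  have hint : IntegrableOn (fun t : ℝ => K ^ 2 * t ^ (2 * α - 1)) (Ioc 0 1) :=
    ((intervalIntegrable_iff_integrableOn_Ioc_of_le zero_le_one).1
      (intervalIntegral.intervalIntegrable_rpow' (by linarith))).const_mul _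
  -- The integrable majorant: `t^(2α-1)` is integrable at 0 because `α > 0`.
  have hle : ∀ t ∈ Ioc (0 : ℝ) 1, ‖f t‖ ^ 2 / t ≤ K ^ 2 * t ^ (2 * α - 1) := by
    rintro t ⟨ht, ht1⟩
    rw [div_le_iff₀ ht, mul_assoc, ← Real.rpow_add_one ht.ne', sub_add_cancel, mul_comm 2 α,
      Real.rpow_mul ht.le, Real.rpow_ofNat, ← mul_pow]
    exact pow_le_pow_left₀ (norm_nonneg _) (h t ht ht1) 2
  have hmeas : AEStronglyMeasurable (fun t : ℝ => ‖f t‖ ^ 2 / t) (volume.restrict (Ioc 0 1)) := by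
    refine ContinuousOn.aestronglyMeasurable (ContinuousOn.div ?_ continuousOn_id
      fun t ht => ht.1.ne') measurableSet_Ioc
    exact (hf.mono fun t ht => ht.1).norm.pow 2
  have hi : IntegrableOn (fun t : ℝ => ‖f t‖ ^ 2 / t) (Ioc 0 1) := by
    refine hint.mono' hmeas ((ae_restrict_mem measurableSet_Ioc).mono fun t ht => ?_)
    rw [Real.norm_of_nonneg (div_nonneg (sq_nonneg _) ht.1.le)]
    exact hle t ht
  refine ⟨hi, (setIntegral_mono_on hi hint measurableSet_Ioc hle).trans (le_of_eq ?_)⟩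
  rw [integral_const_mul, ← intervalIntegral.integral_of_le zero_le_one,
    integral_rpow (Or.inl (by linarith)), sub_add_cancel, Real.one_rpow,
    Real.zero_rpow (by positivity), sub_zero, mul_one_div]

end RobinKato

theorem lemma5 {n : ℕ} (G : RobinKato.Domain n)
    (r q q' : ℝ≥0∞) [Fact (1 ≤ r)] [Fact (1 ≤ q)] [Fact (1 ≤ q')]
    [ENNReal.HolderTriple r q q'] [ENNReal.HolderConjugate q' q]
    (hr : ENNReal.ofReal (G.d / (G.d + 2 - n)) < r)
    (lam M K : ℝ) (hlam : 0 < lam) :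
    ∃ C : ℝ, 0 ≤ C ∧
      ∀ (A : Lp (Matrix (Fin n) (Fin n) ℂ) ⊤ G.vol) (b : Lp ℂ r G.σ), ‖A‖ ≤ M → ‖b‖ ≤ K →
        (∀ u : G.W12, lam * ‖u‖ ^ 2 ≤ (G.form q A b u u).re) →
        ∀ u : G.W12,
          IntegrableOn (fun t : ℝ => ‖G.boundaryTerm q q' A b t u‖ ^ 2 / t) (Ioc 0 1) ∧
          ∫ t in Ioc (0 : ℝ) 1, ‖G.boundaryTerm q q' A b t u‖ ^ 2 / t ≤ C * ‖u‖ ^ 2 := by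
  obtain ⟨α, N, hα, hN⟩ := G.exists_norm_boundaryTerm_le r q q' hr hlam K
  refine ⟨N ^ 2 / (2 * α), by positivity, fun A b _ hb hcoer u => ?_⟩
  obtain ⟨h1, h2⟩ := RobinKato.integral_sq_div_le
    (G.continuousOn_boundaryTerm q q' hlam hcoer u) hα (hN A b hb hcoer u)
  exact ⟨h1, h2.trans_eq (by ring)⟩
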